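/- **Setting.** Let $A=\{a_1<a_2<\cdots\}$ be an infinite totally ordered alphabet. The *Baxter congruence* $\equiv_{\mathrm B}$ is the smallest monoid congruence on the free monoid $A^*$ such that, for all words $u,v$ and letters $\mathtt a,\mathtt b,\mathtt c,\mathtt d$, $$\mathtt c\,u\,\mathtt{ad}\,v\,\mathtt b\equiv_{\mathrm B}\mathtt c\,u\,\mathtt{da}\,v\,\mathtt b\quad(\mathtt a\le \mathtt b<\mathtt c\le \mathtt d),\qquad \mathtt b\,u\,\mathtt{da}\,v\,\mathtt c\equiv_{\mathrm B}\mathtt b\,u\,\mathtt{ad}\,v\,\mathtt c\quad(\mathtt a<\mathtt b\le \mathtt c<\mathtt d).$$ For $n\ge 0$, a permutation in $\mathfrak S_n$ is seen as a word without repetition of length $n$ on the first $n$ letters of $A$; the *Baxter equivalence relation* on $\mathfrak S_n$ is the restriction of $\equiv_{\mathrm B}$. The *permutohedron* of order $n$ is $\mathfrak S_n$ with the order $\le_{\mathrm P}$ (right weak order) that is the reflexive and transitive closure of the relations $u\,\mathtt{ab}\,v\to u\,\mathtt{ba}\,v$ with $\mathtt a<\mathtt b$; it is a lattice. The *canopy*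 of a binary tree is the $0$–$1$ word obtained by reading its leaves from left to right, except the first and the last one, writing $0$ for a right-oriented leaf (a leaf that is a right child) and $1$ for a left-oriented one. A *pair of twin binary trees* is a pair $(T_L,T_R)$ of binary trees with the same number of nodes whose canopies differ at every position; $\mathcal{TBT}_n$ is the set of those with $n$ nodes in each tree. For $\sigma\in\mathfrak S_n$, let $\mathsf P(\sigma)=(T_L,T_R)$ be the pair of unlabeled shapes of the binary search trees obtained by inserting, as leaves, the letters of $\sigma$ from left to right (for $T_L$) and from right to left (for $T_R$). For $J_0,J_1\in\mathcal{TBT}_n$ put $J_0\le_{\mathrm B}J_1$ if there are $\sigma,\nu\in\mathfrak S_n$ with $\sigma\le_{\mathrm P}\nu$, $\mathsf P(\sigma)=J_0$ and $\mathsf P(\nu)=J_1$. **Theorem.** For every $n\ge 0$, the Baxter equivalence relation is a lattice congruence of the permutohedron of order $n$: if $\sigma\equiv_{\mathrm B}\sigma'$ and $\nu\equiv_{\mathrm B}\nu'$, then $\sigma\wedge\nu\equiv_{\mathrm B}\sigma'\wedge\nu'$ and $\sigma\vee\nu\equiv_{\mathrm B}\sigma'\vee\nu'$. Consequently the quotient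 $\mathfrak S_n/_{\equiv_{\mathrm B}}$ is a lattice for the operations $\widehat\sigma\wedge\widehat\nu:=\widehat{\sigma\wedge\nu}$ and $\widehat\sigma\vee\widehat\nu:=\widehat{\sigma\vee\nu}$ induced on classes. Moreover $(\mathcal{TBT}_n,\le_{\mathrm B})$ is a lattice (the *Baxter lattice*), and $\widehat\sigma\mapsto\mathsf P(\sigma)$ is a well-defined lattice isomorphism from $\mathfrak S_n/_{\equiv_{\mathrm B}}$ onto it. -/

import Mathlib

namespace Baxter

/-! ### Words and the Baxter congruence -/

/-- The two Baxter adjacency relations on words. -/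
inductive Adj {A : Type*} [LinearOrder A] : FreeMonoid A → FreeMonoid A → Prop
  | left (u v : FreeMonoid A) (a b c d : A) (hab : a ≤ b) (hbc : b < c) (hcd : c ≤ d) :
      Adj (FreeMonoid.of c * u * FreeMonoid.of a * FreeMonoid.of d * v * FreeMonoid.of b)
        (FreeMonoid.of c * u * FreeMonoid.of d * FreeMonoid.of a * v * FreeMonoid.of b)
  | right (u v : FreeMonoid A) (a b c d : A) (hab : a < b) (hbc : b ≤ c) (hcd : c < d) :
      Adj (FreeMonoid.of b * u * FreeMonoid.of d * FreeMonoid.of a * v * FreeMonoid.of c)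
        (FreeMonoid.of b * u * FreeMonoid.of a * FreeMonoid.of d * v * FreeMonoid.of c)

/-- The Baxter congruence: the congruence of the free monoid generated by the Baxter adjacency
relations. -/
def con (A : Type*) [LinearOrder A] : Con (FreeMonoid A) := conGen Adj

/-! ### Permutations and the permutohedron order -/

/-- A permutation of size `n` seen as a word of length `n` without repetition on the `n` first
letters of the infinite totally ordered alphabet `ℕ = {0 < 1 < 2 < ⋯}`. -/
def word {n : ℕ} (σ : Equiv.Perm (Fin n)) : FreeMonoid ℕ :=
  FreeMonoid.ofList (List.ofFn fun i => (σ i : ℕ))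

/-- `σ = u a b v` and `ν = u b a v` with `a < b`: a covering pair of the permutohedron. -/
def PermCover {n : ℕ} (σ ν : Equiv.Perm (Fin n)) : Prop :=
  ∃ (u v : FreeMonoid ℕ) (a b : ℕ), a < b ∧
    word σ = u * FreeMonoid.of a * FreeMonoid.of b * v ∧
    word ν = u * FreeMonoid.of b * FreeMonoid.of a * v

/-- The (right) permutohedron order. -/
def PermLE {n : ℕ} (σ ν : Equiv.Perm (Fin n)) : Prop :=
  Relation.ReflTransGen PermCover σ ν

/-- The Baxter equivalence relation on permutations of size `n`. -/
def permSetoid (n : ℕ) : Setoid (Equiv.Perm (Fin n)) :=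
  (con ℕ).toSetoid.comap word

/-! ### Pairs of twin binary trees -/

/-- The orientations of the leaves of a binary tree, from left to right: `1` for a left-oriented
leaf (one that is a left child) and `0` for a right-oriented leaf. The first argument is the
orientation given to the tree itself when it is reduced to a leaf. -/
def leafWord (o : Fin 2) : BinaryTree Unit → List (Fin 2)
  | .nil => [o]
  | .node _ l r => leafWord 1 l ++ leafWord 0 r

/-- The canopy: orientations of all the leaves except the first and the last one. (The tree
reduced to a leaf has empty canopy, whatever orientation is given to that leaf.) -/
def canopy (t : BinaryTree Unit) : List (Fin 2) :=
  (leafWord 0 t).tail.dropLast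

/-- Pairs of twin binary trees with `n` nodes each: the canopies (two words of length `n - 1`)
differ at every position. -/
def TwinTrees (n : ℕ) : Type :=
  {J : BinaryTree Unit × BinaryTree Unit //
    J.1.numNodes = n ∧ J.2.numNodes = n ∧
      List.Forall₂ (fun x y => x ≠ y) (canopy J.1) (canopy J.2)}

/-! ### The P-symbol -/

/-- Leaf insertion of a letter in a left binary search tree. -/
def insertLeft {A : Type*} [LinearOrder A] (a : A) : BinaryTree A → BinaryTree A
  | .nil => .node a .nil .nil
  | .node b l r => if a < b then .node b (insertLeft a l) r else .node b l (insertLeft a r)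

/-- Leaf insertion of a letter in a right binary search tree. -/
def insertRight {A : Type*} [LinearOrder A] (a : A) : BinaryTree A → BinaryTree A
  | .nil => .node a .nil .nil
  | .node b l r => if a ≤ b then .node b (insertRight a l) r else .node b l (insertRight a r)

/-- The Baxter P-symbol of a word: the left binary search tree obtained by leaf insertion of its
letters from left to right, and the right binary search tree obtained by leaf insertion of its
letters from right to left. -/
def pSymbol {A : Type*} [LinearOrder A] (w : FreeMonoid A) : BinaryTree A × BinaryTree A :=
  (w.toList.foldl (fun t a => insertLeft a t) .nil, w.toList.foldr insertRight .nil)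

/-- The unlabeled binary tree obtained by forgetting the labels. -/
def shape {A : Type*} (t : BinaryTree A) : BinaryTree Unit := t.map fun _ => ()

/-- The unlabeled P-symbol of a permutation. -/
def permShape {n : ℕ} (σ : Equiv.Perm (Fin n)) : BinaryTree Unit × BinaryTree Unit :=
  (shape (pSymbol (word σ)).1, shape (pSymbol (word σ)).2)

/-- The Baxter order relation on pairs of twin binary trees. -/
def TwinLE {n : ℕ} (J₀ J₁ : TwinTrees n) : Prop :=
  ∃ σ ν : Equiv.Perm (Fin n), PermLE σ ν ∧ permShape σ = J₀.1 ∧ permShape ν = J₁.1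

end Baxter

/-! A permutation is encoded by its inversions, the pairs of values `a < b` with `b` before `a`. The
relations so obtained are exactly the biclosed ones, and the weak order is their inclusion
(`permLE_iff`). A join is the transitive closure of a union; a meet is the same operation on
complements.

The Baxter class of `σ` is determined by two parts of this relation: `Full (inv σ)`, the pairs `(i,
j)` with `j` before every value of `[i, j)`, and `Full (Compl (inv σ))`, those with `j` after every
such value. They are what the left and the right tree shapes remember (`rtree_eq_iff`). Both parts
of a join depend only on the corresponding parts of its two terms (`full_join`, `full_compl_join`),
and dually for meets, so having equal parts is a lattice congruence.

It is the Baxter congruence (`con_iff_twinEquiv`). A Baxter move exchanges adjacent letters `a < d`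
when values between them occur on both sides, and these witnesses hide the exchange from both parts.
Conversely, equivalent permutations are joined to their meet by covers inside the class, and a cover
can preserve both parts only if such witnesses exist.

For surjectivity, the canopies record the relative order of `i` and `i + 1`. When these agree for
two trees, one biclosed relation realises both (`exists_perm_full`). -/

namespace Baxter

/-! ### Biclosed relations -/

section Biclosed

variable {α : Type*} [LinearOrder α]

/-- A transitive relation contained in `<`, whose complement in `<` is transitive. -/
structure Biclosed (X : α → α → Prop) : Prop where
  lt : ∀ {a b}, X a b → a < b
  trans : ∀ {a b c}, X a b → X b c → X a c
  cotrans : ∀ {a b c}, a < b → b < c → X a c → X a b ∨ X b c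

/-- The complement of a relation in `<`. -/
def Compl (X : α → α → Prop) (a b : α) : Prop := a < b ∧ ¬ X a b

/-- The transitive closure of the union of two relations. -/
def Join (X Y : α → α → Prop) : α → α → Prop := Relation.TransGen fun a b => X a b ∨ Y a b

theorem Biclosed.compl {X : α → α → Prop} (h : Biclosed X) : Biclosed (Compl X) where
  lt h := h.1
  trans := fun ⟨h1, h2⟩ ⟨h3, h4⟩ =>
    ⟨h1.trans h3, fun h5 => (h.cotrans h1 h3 h5).elim h2 h4⟩
  cotrans := fun {a b c} h1 h2 ⟨_, h4⟩ => by
    by_contra hc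
    have := @h.trans a b c
    simp only [Compl] at hc
    tauto

theorem Biclosed.compl_compl {X : α → α → Prop} (h : Biclosed X) : Compl (Compl X) = X := by
  ext a b
  have := @h.lt a b
  simp only [Compl]
  tauto

theorem Compl.anti {X Y : α → α → Prop} (h : ∀ a b, X a b → Y a b) {a b : α}
    (hY : Compl Y a b) : Compl X a b :=
  ⟨hY.1, fun hX => hY.2 (h a b hX)⟩

omit [LinearOrder α] in
theorem Join.left {X Y : α → α → Prop} {a b : α} (h : X a b) : Join X Y a b :=
  .single (.inl h)

omit [LinearOrder α] in
theorem Join.right {X Y : α → α → Prop} {a b : α} (h : Y a b) : Join X Y a b :=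
  .single (.inr h)

theorem Join.le {X Y Z : α → α → Prop} (hZ : Biclosed Z) (hX : ∀ a b, X a b → Z a b)
    (hY : ∀ a b, Y a b → Z a b) {a b : α} (h : Join X Y a b) : Z a b := by
  induction h with
  | single h => exact h.elim (hX _ _) (hY _ _)
  | tail _ h ih => exact hZ.trans ih (h.elim (hX _ _) (hY _ _))

/-- For cotransitivity, a chain from `a` to `c` either visits `b` or jumps over it in a single step
of `X` or `Y`, which is then cut at `b`. -/
theorem Biclosed.join {X Y : α → α → Prop} (hX : Biclosed X) (hY : Biclosed Y) :
    Biclosed (Join X Y) where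
  lt {a b} h := by
    induction h with
    | single h => exact h.elim hX.lt hY.lt
    | tail _ h ih => exact ih.trans (h.elim hX.lt hY.lt)
  trans h1 h2 := h1.trans h2
  cotrans {a b c} h1 h2 h := by
    have step : ∀ {x y}, (X x y ∨ Y x y) → x < b → b < y → Join X Y x b ∨ Join X Y b y := by
      rintro x y (h | h) hx hy
      · exact (hX.cotrans hx hy h).imp Join.left Join.left
      · exact (hY.cotrans hx hy h).imp Join.right Join.right
    induction h with
    | single h => exact step h h1 h2
    | @tail x y hax h ih =>
      rcases lt_trichotomy b x with hb | rfl | hb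
      · exact (ih hb).imp id fun h' => h'.tail h
      · exact .inl hax
      · exact (step h hb h2).imp (fun h' => hax.trans h') id

/-! ### Left-full parts -/

/-- The pairs `(i, j)` such that `X k j` for all `k` in the interval `[i, j)`. -/
def Full (X : α → α → Prop) (i j : α) : Prop := i < j ∧ ∀ k, i ≤ k → k < j → X k j

theorem Full.rel {X : α → α → Prop} {i j : α} (h : Full X i j) : X i j := h.2 i le_rfl h.1

theorem Full.mono {X Y : α → α → Prop} (h : ∀ a b, X a b → Y a b) {i j : α} (hX : Full X i j) :
    Full Y i j :=
  ⟨hX.1, fun k h1 h2 => h k j (hX.2 k h1 h2)⟩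

theorem Full.shrink {X : α → α → Prop} {i j k : α} (h : Full X i j) (hk : i ≤ k) (hj : k < j) :
    Full X k j :=
  ⟨hj, fun m h1 h2 => h.2 m (hk.trans h1) h2⟩

/-- Fullness survives moving the left end to the right, so cotransitivity always holds through its
second alternative. -/
theorem Biclosed.full {X : α → α → Prop} (hX : Biclosed X) : Biclosed (Full X) where
  lt h := h.1
  trans {a b c} h1 h2 := ⟨h1.1.trans h2.1, fun k hk hc => by
    rcases lt_or_ge k b with hb | hb
    · exact hX.trans (h1.2 k hk hb) h2.rel
    · exact h2.2 k hb hc⟩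
  cotrans h1 h2 h := .inr (h.shrink h1.le h2)

/-- A chain from `k ≥ i` to `j` ends with a single step of `X` or `Y` into `j`, starting in `[i,
j)`; fullness of the complements forbids that step. -/
theorem full_compl_join {X Y : α → α → Prop} (hX : Biclosed X) (hY : Biclosed Y) {i j : α} :
    Full (Compl (Join X Y)) i j ↔ Full (Compl X) i j ∧ Full (Compl Y) i j := by
  refine ⟨fun h => ⟨h.mono fun a b => Compl.anti fun _ _ => Join.left,
    h.mono fun a b => Compl.anti fun _ _ => Join.right⟩,
    fun ⟨h1, h2⟩ => ⟨h1.1, fun k hk hj => ⟨hj, fun h => ?_⟩⟩⟩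
  have key : ∀ m, i ≤ m → (X m j ∨ Y m j) → False := by
    rintro m hm (h | h)
    · exact (h1.2 m hm (hX.lt h)).2 h
    · exact (h2.2 m hm (hY.lt h)).2 h
  obtain ⟨m, hm, h⟩ := Relation.TransGen.tail'_iff.1 h
  refine key m (hk.trans ?_) h
  rcases Relation.reflTransGen_iff_eq_or_transGen.1 hm with rfl | hm
  · exact le_rfl
  · exact ((hX.join hY).lt hm).le

/-- Take the least `l` with `X k l`. Any `p` strictly between has `X k p` or `X p l`, and minimality
excludes the former. -/
theorem exists_full_of_rel [WellFoundedLT α] {X : α → α → Prop} (hX : Biclosed X) {k m : α}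
    (h : X k m) : ∃ l, l ≤ m ∧ Full X k l := by
  obtain ⟨l, hl, hmin⟩ := wellFounded_lt.has_min {l | X k l} ⟨m, h⟩
  refine ⟨l, not_lt.1 (hmin m h), hX.lt hl, fun p hp hpl => ?_⟩
  rcases hp.eq_or_lt with rfl | hp
  · exact hl
  · exact (hX.cotrans hp hpl hl).resolve_left fun h => hmin p h hpl

/-- Descending induction on `k`: the first step of a chain from `k` to `j` is replaced by a full
step to some `l ≤ j`, and the hypothesis at `l` supplies the rest. -/
theorem full_join_aux [WellFoundedLT α] [WellFoundedGT α] {X Y : α → α → Prop} (hX : Biclosed X)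
    (hY : Biclosed Y) {i j : α} (h : ∀ k, i ≤ k → k < j → Join X Y k j) (k : α) :
    i ≤ k → k < j → Join (Full X) (Full Y) k j := by
  induction k using (wellFounded_gt (α := α)).induction with
  | _ k ih =>
  intro hk hj
  obtain ⟨m, hkm, hmj⟩ := Relation.TransGen.head'_iff.1 (h k hk hj)
  have hmj : m ≤ j := by
    rcases Relation.reflTransGen_iff_eq_or_transGen.1 hmj with rfl | hm
    · exact le_rfl
    · exact ((hX.join hY).lt hm).le
  have next : ∀ l, k < l → l ≤ m → Join (Full X) (Full Y) k l →
      Join (Full X) (Full Y) k j := by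
    intro l hkl hlm hl
    rcases (hlm.trans hmj).eq_or_lt with rfl | hlj
    · exact hl
    · exact hl.trans (ih l hkl (hk.trans hkl.le) hlj)
  rcases hkm with hkm | hkm
  · obtain ⟨l, hl, hf⟩ := exists_full_of_rel hX hkm
    exact next l hf.1 hl (Join.left hf)
  · obtain ⟨l, hl, hf⟩ := exists_full_of_rel hY hkm
    exact next l hf.1 hl (Join.right hf)

theorem full_join [WellFoundedLT α] [WellFoundedGT α] {X Y : α → α → Prop} (hX : Biclosed X)
    (hY : Biclosed Y) : Full (Join X Y) = Full (Join (Full X) (Full Y)) := by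
  ext i j
  refine ⟨fun h => ⟨h.1, full_join_aux hX hY h.2⟩, fun h => h.mono fun a b hab => ?_⟩
  exact Join.le (hX.join hY) (fun _ _ h => Join.left h.rel) (fun _ _ h => Join.right h.rel) hab

end Biclosed

/-! ### Permutations and biclosed relations -/

section Perm

variable {n : ℕ}

/-- The inversions of a permutation: pairs of values `a < b` with `b` before `a`. -/
def inv (σ : Equiv.Perm (Fin n)) (a b : Fin n) : Prop := a < b ∧ σ.symm b < σ.symm a

theorem biclosed_inv (σ : Equiv.Perm (Fin n)) : Biclosed (inv σ) where
  lt h := h.1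
  trans h1 h2 := ⟨h1.1.trans h2.1, h2.2.trans h1.2⟩
  cotrans {a b c} h1 h2 h := by
    by_contra hc
    simp only [inv, h1, h2, true_and, not_or, not_lt] at hc
    exact absurd h.2 (not_lt.2 (hc.1.trans hc.2))

theorem compl_inv_iff {σ : Equiv.Perm (Fin n)} {a b : Fin n} :
    Compl (inv σ) a b ↔ a < b ∧ σ.symm a < σ.symm b := by
  simp only [Compl, inv]
  constructor
  · rintro ⟨h1, h2⟩
    refine ⟨h1, lt_of_le_of_ne (not_lt.1 fun h => h2 ⟨h1, h⟩) fun h => h1.ne (σ.symm.injective h)⟩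
  · rintro ⟨h1, h2⟩
    exact ⟨h1, fun h => h.2.not_gt h2⟩

/-- The only increasing bijection of `Fin n` is the identity. -/
theorem eq_of_before {σ ν : Equiv.Perm (Fin n)}
    (h : ∀ a b, σ.symm a < σ.symm b → ν.symm a < ν.symm b) : σ = ν := by
  have hm : StrictMono (σ.trans ν.symm) := fun i j hij => by
    simpa using h (σ i) (σ j) (by simpa using hij)
  have : (σ.trans ν.symm) = Equiv.refl _ := by
    have := Subsingleton.elim (hm.orderIsoOfSurjective _ (σ.trans ν.symm).surjective)
      (OrderIso.refl (Fin n))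
    ext i
    exact congrArg (fun e : Fin n ≃o Fin n => (e i : ℕ)) this
  ext i
  have := congrArg (fun e : Equiv.Perm (Fin n) => (ν (e i) : ℕ)) this
  simpa using this

theorem inv_injective : Function.Injective (inv (n := n)) := by
  intro σ ν h
  refine eq_of_before fun a b hab => ?_
  rcases lt_trichotomy a b with h1 | rfl | h1
  · have : Compl (inv σ) a b := compl_inv_iff.2 ⟨h1, hab⟩
    rw [h] at this
    exact (compl_inv_iff.1 this).2
  · exact absurd hab (lt_irrefl _)
  · have : inv σ b a := ⟨h1, hab⟩
    rw [h] at this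
    exact this.2

/-- The linear order on values whose inversions are a given biclosed relation. -/
def Before (X : Fin n → Fin n → Prop) (a b : Fin n) : Prop := Compl X a b ∨ X b a

theorem Biclosed.before_trans {X : Fin n → Fin n → Prop} (hX : Biclosed X) {a b c : Fin n}
    (h1 : Before X a b) (h2 : Before X b c) : Before X a c := by
  have hC := hX.compl
  have split : ∀ {x y : Fin n}, x < y → ¬ Compl X x y → X x y := fun h h' => by
    by_contra h''
    exact h' ⟨h, h''⟩
  rcases h1 with h1 | h1 <;> rcases h2 with h2 | h2
  · exact .inl (hC.trans h1 h2)
  · rcases lt_trichotomy a c with h | rfl | h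
    · left
      by_contra hn
      exact h1.2 (hX.trans (split h hn) h2)
    · exact absurd h2 h1.2
    · right
      exact (hX.cotrans h h1.1 h2).resolve_right h1.2
  · rcases lt_trichotomy a c with h | rfl | h
    · left
      exact (hC.cotrans (hX.lt h1) h h2).resolve_left fun h' => h'.2 h1
    · exact absurd h1 h2.2
    · right
      exact (hX.cotrans h2.1 h h1).resolve_left h2.2
  · exact .inr (hX.trans h2 h1)

/-- `Before X` is a strict linear order, and the position of a value is the number of values before
it. -/
theorem Biclosed.exists_perm {X : Fin n → Fin n → Prop} (hX : Biclosed X) :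
    ∃ σ : Equiv.Perm (Fin n), inv σ = X := by
  classical
  have hirr : ∀ a, ¬ Before X a a := by
    rintro a (h | h)
    · exact lt_irrefl _ h.1
    · exact lt_irrefl _ (hX.lt h)
  have htot : ∀ a b, a ≠ b → Before X a b ∨ Before X b a := by
    intro a b hab
    simp only [Before, Compl]
    rcases lt_or_gt_of_ne hab with h | h <;> tauto
  let rank : Fin n → Finset (Fin n) := fun a => Finset.univ.filter fun c => Before X c a
  have hmono : ∀ a b, Before X a b → (rank a).card < (rank b).card := by
    intro a b hab
    refine Finset.card_lt_card (Finset.ssubset_iff_subset_ne.2 ⟨fun c hc => ?_, fun h => ?_⟩)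
    · simp only [rank, Finset.mem_filter, Finset.mem_univ, true_and] at hc ⊢
      exact hX.before_trans hc hab
    · have : a ∈ rank b := by simpa [rank] using hab
      rw [← h] at this
      exact hirr a (by simpa [rank] using this)
  have hlt : ∀ a, (rank a).card < n := fun a => by
    have := Finset.card_lt_univ_of_notMem (s := rank a) (x := a) (by simpa [rank] using hirr a)
    simpa using this
  let f : Fin n → Fin n := fun a => ⟨(rank a).card, hlt a⟩
  have hinj : Function.Injective f := by
    intro a b hab
    by_contra hne
    have hab : (rank a).card = (rank b).card := congrArg Fin.val hab
    rcases htot a b hne with h | h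
    · exact (hmono _ _ h).ne hab
    · exact (hmono _ _ h).ne' hab
  refine ⟨(Equiv.ofBijective f (Finite.injective_iff_bijective.1 hinj)).symm, ?_⟩
  ext a b
  simp only [inv, Equiv.symm_symm, Equiv.ofBijective_apply]
  constructor
  · rintro ⟨h1, h2⟩
    by_contra h
    exact lt_asymm h2 (hmono a b (.inl ⟨h1, h⟩))
  · intro h
    exact ⟨hX.lt h, hmono b a (.inr h)⟩

/-- A permutation whose inversions are a given biclosed relation. -/
noncomputable def Biclosed.perm {X : Fin n → Fin n → Prop} (hX : Biclosed X) :
    Equiv.Perm (Fin n) := hX.exists_perm.choose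

theorem Biclosed.inv_perm {X : Fin n → Fin n → Prop} (hX : Biclosed X) : inv hX.perm = X :=
  hX.exists_perm.choose_spec

theorem biclosed_join_inv (σ ν : Equiv.Perm (Fin n)) : Biclosed (Join (inv σ) (inv ν)) :=
  (biclosed_inv σ).join (biclosed_inv ν)

theorem biclosed_meet_inv (σ ν : Equiv.Perm (Fin n)) :
    Biclosed (Compl (Join (Compl (inv σ)) (Compl (inv ν)))) :=
  ((biclosed_inv σ).compl.join (biclosed_inv ν).compl).compl

/-- The weak order on permutations, as inclusion of inversions. -/
@[reducible] noncomputable def weakOrder (n : ℕ) : Lattice (Equiv.Perm (Fin n)) where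
  le σ ν := ∀ a b, inv σ a b → inv ν a b
  le_refl σ a b h := h
  le_trans σ ν ρ h1 h2 a b h := h2 a b (h1 a b h)
  le_antisymm σ ν h1 h2 := inv_injective (funext fun a => funext fun b =>
    propext ⟨h1 a b, h2 a b⟩)
  sup σ ν := (biclosed_join_inv σ ν).perm
  inf σ ν := (biclosed_meet_inv σ ν).perm
  le_sup_left σ ν a b h := by
    rw [Biclosed.inv_perm]
    exact Join.left h
  le_sup_right σ ν a b h := by
    rw [Biclosed.inv_perm]
    exact Join.right h
  sup_le σ ν ρ h1 h2 a b h := by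
    rw [Biclosed.inv_perm] at h
    exact Join.le (biclosed_inv ρ) h1 h2 h
  inf_le_left σ ν a b h := by
    rw [Biclosed.inv_perm] at h
    rw [← (biclosed_inv σ).compl_compl]
    exact Compl.anti (fun _ _ => Join.left) h
  inf_le_right σ ν a b h := by
    rw [Biclosed.inv_perm] at h
    rw [← (biclosed_inv ν).compl_compl]
    exact Compl.anti (fun _ _ => Join.right) h
  le_inf σ ν ρ h1 h2 a b h := by
    rw [Biclosed.inv_perm]
    refine ⟨h.1, fun h' => ?_⟩
    exact (Join.le (biclosed_inv σ).compl (fun _ _ => Compl.anti h1)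
      (fun _ _ => Compl.anti h2) h').2 h

theorem inv_sup (σ ν : Equiv.Perm (Fin n)) :
    inv ((weakOrder n).sup σ ν) = Join (inv σ) (inv ν) := Biclosed.inv_perm _

theorem compl_inv_inf (σ ν : Equiv.Perm (Fin n)) :
    Compl (inv ((weakOrder n).inf σ ν)) = Join (Compl (inv σ)) (Compl (inv ν)) := by
  refine (congrArg Compl (Biclosed.inv_perm _)).trans (Biclosed.compl_compl ?_)
  exact (biclosed_inv σ).compl.join (biclosed_inv ν).compl

/-! ### The Baxter equivalence in terms of inversions -/

/-- Two permutations are twin-equivalent when, for all values `i < j`, the one has `j` after (resp.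
before) all values of `[i, j)` if and only if the other one has. -/
def TwinEquiv (σ ν : Equiv.Perm (Fin n)) : Prop :=
  Full (inv σ) = Full (inv ν) ∧ Full (Compl (inv σ)) = Full (Compl (inv ν))

theorem TwinEquiv.sup {σ σ' ν ν' : Equiv.Perm (Fin n)} (h1 : TwinEquiv σ σ')
    (h2 : TwinEquiv ν ν') : TwinEquiv ((weakOrder n).sup σ ν) ((weakOrder n).sup σ' ν') := by
  constructor
  · rw [inv_sup, inv_sup, full_join (biclosed_inv _) (biclosed_inv _),
      full_join (biclosed_inv _) (biclosed_inv _), h1.1, h2.1]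
  · ext i j
    rw [inv_sup, inv_sup, full_compl_join (biclosed_inv _) (biclosed_inv _),
      full_compl_join (biclosed_inv _) (biclosed_inv _), h1.2, h2.2]

theorem TwinEquiv.inf {σ σ' ν ν' : Equiv.Perm (Fin n)} (h1 : TwinEquiv σ σ')
    (h2 : TwinEquiv ν ν') : TwinEquiv ((weakOrder n).inf σ ν) ((weakOrder n).inf σ' ν') := by
  constructor
  · ext i j
    rw [← (biclosed_inv ((weakOrder n).inf σ ν)).compl_compl,
      ← (biclosed_inv ((weakOrder n).inf σ' ν')).compl_compl, compl_inv_inf, compl_inv_inf,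
      full_compl_join (biclosed_inv _).compl (biclosed_inv _).compl,
      full_compl_join (biclosed_inv _).compl (biclosed_inv _).compl,
      (biclosed_inv σ).compl_compl, (biclosed_inv σ').compl_compl,
      (biclosed_inv ν).compl_compl, (biclosed_inv ν').compl_compl, h1.1, h2.1]
  · rw [compl_inv_inf, compl_inv_inf, full_join (biclosed_inv _).compl (biclosed_inv _).compl,
      full_join (biclosed_inv _).compl (biclosed_inv _).compl, h1.2, h2.2]

end Perm
/-! ### Words of permutations -/

section Words

/-- Containing `[x, y]` is the failure of a `Pairwise` condition, so this is the splitting of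
`Pairwise` over an append. -/
theorem pair_sublist_append {A : Type*} {x y : A} {l₁ l₂ : List A} :
    [x, y].Sublist (l₁ ++ l₂) ↔
      [x, y].Sublist l₁ ∨ (x ∈ l₁ ∧ y ∈ l₂) ∨ [x, y].Sublist l₂ := by
  have h := List.pairwise_append (R := fun p q => ¬ (p = x ∧ q = y)) (l₁ := l₁) (l₂ := l₂)
  have key : ∀ l : List A, l.Pairwise (fun p q => ¬ (p = x ∧ q = y)) ↔ ¬ [x, y].Sublist l := by
    intro l
    rw [List.pairwise_iff_forall_sublist]
    exact ⟨fun h h' => h h' ⟨rfl, rfl⟩, fun h p q hpq ⟨h1, h2⟩ => h (h1 ▸ h2 ▸ hpq)⟩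
  rw [key, key, key] at h
  have h3 : (∀ a ∈ l₁, ∀ b ∈ l₂, ¬ (a = x ∧ b = y)) ↔ ¬ (x ∈ l₁ ∧ y ∈ l₂) :=
    ⟨fun h h' => h _ h'.1 _ h'.2 ⟨rfl, rfl⟩, fun h a ha b hb ⟨h1, h2⟩ =>
      h ⟨h1 ▸ ha, h2 ▸ hb⟩⟩
  rw [h3] at h
  tauto

theorem pair_sublist_ofFn {A : Type*} {n : ℕ} {f : Fin n → A} {x y : A} :
    [x, y].Sublist (List.ofFn f) ↔ ∃ i j, i < j ∧ f i = x ∧ f j = y := by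
  have h := List.pairwise_ofFn (R := fun p q => ¬ (p = x ∧ q = y)) (f := f)
  rw [List.pairwise_iff_forall_sublist] at h
  constructor
  · intro hs
    by_contra hc
    push Not at hc
    exact h.2 (fun i j hij h' => hc i j hij h'.1 h'.2) hs ⟨rfl, rfl⟩
  · rintro ⟨i, j, hij, rfl, rfl⟩
    by_contra hc
    exact h.1 (fun {a b} hab ⟨h1, h2⟩ => hc (h1 ▸ h2 ▸ hab)) hij ⟨rfl, rfl⟩

theorem pair_sublist_swap {A : Type*} {u v : List A} {a b x y : A} (hne : ¬ (x = a ∧ y = b))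
    (h : [x, y].Sublist (u ++ [a, b] ++ v)) : [x, y].Sublist (u ++ [b, a] ++ v) := by
  simp only [pair_sublist_append, List.mem_append, List.mem_cons, List.not_mem_nil,
    or_false] at h ⊢
  have : ¬ [x, y].Sublist [a, b] := fun h' => by
    have := h'.eq_of_length (by simp)
    simp only [List.cons.injEq, and_true] at this
    exact hne this
  tauto

variable {n : ℕ}

theorem toList_word (σ : Equiv.Perm (Fin n)) :
    (word σ).toList = List.ofFn fun i => (σ i : ℕ) := rfl

theorem pair_sublist_word {σ : Equiv.Perm (Fin n)} {a b : Fin n} :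
    [(a : ℕ), (b : ℕ)].Sublist (word σ).toList ↔ σ.symm a < σ.symm b := by
  rw [toList_word, pair_sublist_ofFn]
  constructor
  · rintro ⟨i, j, hij, hi, hj⟩
    rw [← Fin.ext hi, ← Fin.ext hj]
    simpa using hij
  · exact fun h => ⟨_, _, h, by simp, by simp⟩

theorem inv_iff_sublist {σ : Equiv.Perm (Fin n)} {a b : Fin n} :
    inv σ a b ↔ a < b ∧ [(b : ℕ), (a : ℕ)].Sublist (word σ).toList := by
  rw [pair_sublist_word, inv]

theorem nodup_word (σ : Equiv.Perm (Fin n)) : (word σ).toList.Nodup := by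
  rw [toList_word, List.nodup_ofFn]
  exact Fin.val_injective.comp σ.injective

theorem mem_word {σ : Equiv.Perm (Fin n)} {x : ℕ} : x ∈ (word σ).toList ↔ x < n := by
  rw [toList_word, List.mem_ofFn']
  constructor
  · rintro ⟨i, rfl⟩
    exact (σ i).2
  · exact fun h => ⟨σ.symm ⟨x, h⟩, by simp⟩

theorem exists_perm_of_word {l : List ℕ} (hn : l.Nodup) (hl : ∀ x, x ∈ l ↔ x < n) :
    ∃ σ : Equiv.Perm (Fin n), (word σ).toList = l := by
  have hp : l.Perm (List.range n) :=
    (List.perm_ext_iff_of_nodup hn List.nodup_range).2 fun x => by rw [hl, List.mem_range]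
  have hlen : l.length = n := by simpa using hp.length_eq
  subst hlen
  let f : Fin l.length → Fin l.length := fun i => ⟨l.get i, (hl _).1 (l.get_mem i)⟩
  have hf : Function.Injective f := fun i j hij =>
    List.nodup_iff_injective_get.1 hn (congrArg Fin.val hij)
  refine ⟨Equiv.ofBijective f (Finite.injective_iff_bijective.1 hf), ?_⟩
  rw [toList_word]
  exact List.ofFn_get l

theorem permCover_iff {σ ν : Equiv.Perm (Fin n)} :
    PermCover σ ν ↔ ∃ (u v : List ℕ) (a b : ℕ), a < b ∧
      (word σ).toList = u ++ [a, b] ++ v ∧ (word ν).toList = u ++ [b, a] ++ v := by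
  constructor
  · rintro ⟨u, v, a, b, hab, h1, h2⟩
    exact ⟨u.toList, v.toList, a, b, hab, by simp [h1, FreeMonoid.toList_mul],
      by simp [h2, FreeMonoid.toList_mul]⟩
  · rintro ⟨u, v, a, b, hab, h1, h2⟩
    refine ⟨.ofList u, .ofList v, a, b, hab, FreeMonoid.toList.injective ?_,
      FreeMonoid.toList.injective ?_⟩
    · simp [h1, FreeMonoid.toList_mul]
    · simp [h2, FreeMonoid.toList_mul]

/-! ### The permutohedron order is the inclusion of inversions -/

theorem inv_of_permCover {σ ν : Equiv.Perm (Fin n)} (h : PermCover σ ν) {a b : Fin n}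
    (hi : inv σ a b) : inv ν a b := by
  obtain ⟨u, v, x, y, hxy, h1, h2⟩ := permCover_iff.1 h
  rw [inv_iff_sublist, h1] at hi
  rw [inv_iff_sublist, h2]
  refine ⟨hi.1, pair_sublist_swap ?_ hi.2⟩
  rintro ⟨rfl, rfl⟩
  exact absurd hi.1 (not_lt.2 hxy.le)

theorem inv_of_permLE {σ ν : Equiv.Perm (Fin n)} (h : PermLE σ ν) :
    ∀ {a b : Fin n}, inv σ a b → inv ν a b := by
  induction h with
  | refl => exact id
  | tail _ h ih => exact fun hi => inv_of_permCover h (ih hi)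

/-- Otherwise `ν` would keep every two consecutive letters of `σ` in the same order, hence all
letters, and the two would be equal. -/
theorem exists_adjacent {σ ν : Equiv.Perm (Fin n)} (h : ∀ a b, inv σ a b → inv ν a b)
    (hne : σ ≠ ν) : ∃ (i : ℕ) (hi : i + 1 < n),
      σ ⟨i, by omega⟩ < σ ⟨i + 1, hi⟩ ∧ inv ν (σ ⟨i, by omega⟩) (σ ⟨i + 1, hi⟩) := by
  by_contra hc
  push Not at hc
  apply hne
  have hstep : ∀ (i : ℕ) (hi : i + 1 < n),
      ν.symm (σ ⟨i, by omega⟩) < ν.symm (σ ⟨i + 1, hi⟩) := by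
    intro i hi
    rcases lt_trichotomy (σ ⟨i, by omega⟩) (σ ⟨i + 1, hi⟩) with h1 | h1 | h1
    · exact (compl_inv_iff.1 ⟨h1, hc i hi h1⟩).2
    · simp at h1
    · exact (h _ _ ⟨h1, by simp⟩).2
  have hmono : StrictMono fun i => ν.symm (σ i) := by
    cases n with
    | zero => exact fun i => i.elim0
    | succ m =>
      rw [Fin.strictMono_iff_lt_succ]
      exact fun i => hstep i (by omega)
  exact eq_of_before fun a b hab => by simpa using hmono hab

theorem take_append_pair_append_drop {A : Type*} (l : List A) {i : ℕ} (hi : i + 1 < l.length) :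
    l = l.take i ++ [l[i], l[i + 1]] ++ l.drop (i + 2) := by
  conv_lhs => rw [← List.take_append_drop i l, List.drop_eq_getElem_cons (by omega),
    List.drop_eq_getElem_cons hi]
  simp

theorem permCover_mul_swap {σ : Equiv.Perm (Fin n)} {i : ℕ} (hi : i + 1 < n)
    (h : σ ⟨i, by omega⟩ < σ ⟨i + 1, hi⟩) :
    PermCover σ (σ * Equiv.swap ⟨i, by omega⟩ ⟨i + 1, hi⟩) := by
  rw [permCover_iff]
  set τ := σ * Equiv.swap ⟨i, by omega⟩ ⟨i + 1, hi⟩ with hτ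
  have hlen : ∀ ρ : Equiv.Perm (Fin n), (word ρ).toList.length = n := fun ρ => by
    simp [toList_word]
  have hother : ∀ k (hk : k < n), k ≠ i → k ≠ i + 1 → τ ⟨k, hk⟩ = σ ⟨k, hk⟩ := by
    intro k hk h1 h2
    rw [hτ, Equiv.Perm.mul_apply, Equiv.swap_apply_of_ne_of_ne] <;> simpa [Fin.ext_iff]
  have htake : (word τ).toList.take i = (word σ).toList.take i := by
    refine List.ext_getElem (by simp [hlen]) fun k h1 h2 => ?_
    rw [List.length_take] at h1
    simp only [List.getElem_take, toList_word, List.getElem_ofFn]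
    rw [hother] <;> omega
  have hdrop : (word τ).toList.drop (i + 2) = (word σ).toList.drop (i + 2) := by
    refine List.ext_getElem (by simp [hlen]) fun k h1 h2 => ?_
    simp only [List.getElem_drop, toList_word, List.getElem_ofFn]
    rw [hother] <;> omega
  refine ⟨(word σ).toList.take i, (word σ).toList.drop (i + 2), _, _, Fin.lt_def.1 h, ?_, ?_⟩
  · refine (take_append_pair_append_drop (word σ).toList (i := i) (by rwa [hlen])).trans ?_
    simp [toList_word]
  · refine (take_append_pair_append_drop (word τ).toList (i := i) (by rwa [hlen])).trans ?_
    rw [htake, hdrop]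
    simp [toList_word, hτ]

theorem permLE_iff {σ ν : Equiv.Perm (Fin n)} :
    PermLE σ ν ↔ ∀ a b, inv σ a b → inv ν a b := by
  refine ⟨fun h a b => inv_of_permLE h, ?_⟩
  let _ := weakOrder n
  induction σ using (wellFounded_gt (α := Equiv.Perm (Fin n))).induction with
  | _ σ ih =>
  intro h
  by_cases hne : σ = ν
  · exact hne ▸ .refl
  obtain ⟨i, hi, h1, h2⟩ := exists_adjacent h hne
  have hc := permCover_mul_swap hi h1
  set τ := σ * Equiv.swap ⟨i, by omega⟩ ⟨i + 1, hi⟩ with hτ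
  refine Relation.ReflTransGen.head hc (ih τ ?_ ?_)
  · refine lt_of_le_of_ne (fun a b => inv_of_permCover hc) fun he => ?_
    have := congrArg (fun e : Equiv.Perm (Fin n) => e ⟨i, by omega⟩) he
    simp [hτ] at this
  · rintro a b ⟨hab, hs⟩
    by_cases hs' : σ.symm b < σ.symm a
    · exact h a b ⟨hab, hs'⟩
    obtain ⟨p, rfl⟩ := σ.surjective a
    obtain ⟨q, rfl⟩ := σ.surjective b
    -- An adjacent exchange creates no inversion but that of the exchanged letters, which `ν` has by
    -- choice of `i`.
    have : p = ⟨i, by omega⟩ ∧ q = ⟨i + 1, hi⟩ := by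
      have hpq : p ≠ q := fun h => hab.ne (congrArg σ h)
      have hsymm : ∀ k, τ.symm (σ k) = Equiv.swap ⟨i, by omega⟩ ⟨i + 1, hi⟩ k := fun k => by
        rw [Equiv.symm_apply_eq]
        simp [hτ]
      simp only [hsymm, Equiv.symm_apply_apply, Equiv.swap_apply_def, Fin.ext_iff] at hs hs' hpq ⊢
      simp only [Fin.lt_def] at hs hs'
      split_ifs at hs <;> simp at hs <;> omega
    rw [this.1, this.2]
    exact h2

end Words
/-! ### Shapes of binary search trees -/

section Trees

/-- The shape of the right binary search tree of a word, inserted from right to left. -/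
def rtree (w : List ℕ) : BinaryTree Unit := shape (w.foldr insertRight .nil)

/-- The shape of the left binary search tree of a word, inserted from left to right. -/
def ltree (w : List ℕ) : BinaryTree Unit := shape (w.foldl (fun t a => insertLeft a t) .nil)

theorem foldr_insertRight_node (b : ℕ) (w : List ℕ) (l r : BinaryTree ℕ) :
    w.foldr insertRight (.node b l r) =
      .node b ((w.filter (· ≤ b)).foldr insertRight l)
        ((w.filter (b < ·)).foldr insertRight r) := by
  induction w with
  | nil => rfl
  | cons x w ih =>
    rw [List.foldr_cons, ih, insertRight]
    by_cases h : x ≤ b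
    · simp [h, not_lt.2 h]
    · simp [h, not_le.1 h]

theorem foldr_insertLeft_node (b : ℕ) (w : List ℕ) (l r : BinaryTree ℕ) :
    w.foldr insertLeft (.node b l r) =
      .node b ((w.filter (· < b)).foldr insertLeft l)
        ((w.filter (b ≤ ·)).foldr insertLeft r) := by
  induction w with
  | nil => rfl
  | cons x w ih =>
    rw [List.foldr_cons, ih, insertLeft]
    by_cases h : x < b
    · simp [h, not_le.2 h]
    · simp [h, not_lt.1 h]

/-- The two insertions differ only on ties. This reduces left trees to right trees of reversed
words. -/
theorem foldr_insertLeft_eq (m : ℕ) : ∀ w : List ℕ, w.length = m → w.Nodup →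
    w.foldr insertLeft .nil = w.foldr insertRight .nil := by
  induction m using Nat.strong_induction_on with
  | _ m ih =>
  intro w hm hw
  rcases List.eq_nil_or_concat' w with rfl | ⟨w, b, rfl⟩
  · rfl
  have hb : b ∉ w := by
    have := (List.nodup_append'.1 hw).2.2
    simpa [List.disjoint_singleton] using this
  have hw := (List.nodup_append'.1 hw).1
  have hlen : ∀ p : ℕ → Bool, (w.filter p).length < m := fun p =>
    (List.length_filter_le p w).trans_lt (by simp [← hm])
  have h1 : w.filter (· < b) = w.filter (· ≤ b) := List.filter_congr fun x hx => by
    have : x ≠ b := fun h => hb (h ▸ hx)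
    simp only [decide_eq_decide]
    omega
  have h2 : w.filter (b ≤ ·) = w.filter (b < ·) := List.filter_congr fun x hx => by
    have : x ≠ b := fun h => hb (h ▸ hx)
    simp only [decide_eq_decide]
    omega
  simp only [List.foldr_append, List.foldr_cons, List.foldr_nil, insertLeft, insertRight]
  rw [foldr_insertRight_node, foldr_insertLeft_node, h1, h2, ih _ (hlen _) _ rfl (hw.filter _),
    ih _ (hlen _) _ rfl (hw.filter _)]

theorem ltree_eq {w : List ℕ} (hw : w.Nodup) : ltree w = rtree w.reverse := by
  rw [ltree, rtree, ← foldr_insertLeft_eq _ w.reverse rfl (List.nodup_reverse.2 hw),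
    List.foldr_reverse]

theorem rtree_concat (w : List ℕ) (b : ℕ) :
    rtree (w ++ [b]) = .node () (rtree (w.filter (· ≤ b))) (rtree (w.filter (b < ·))) := by
  rw [rtree, List.foldr_append]
  change shape (List.foldr insertRight (.node b .nil .nil) w) = _
  rw [foldr_insertRight_node]
  rfl

theorem numNodes_insertRight (a : ℕ) (t : BinaryTree ℕ) :
    (insertRight a t).numNodes = t.numNodes + 1 := by
  induction t with
  | nil => rfl
  | node b l r ihl ihr =>
    rw [insertRight]
    split_ifs <;> simp only [BinaryTree.numNodes, ihl, ihr] <;> omega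

theorem numNodes_shape {A : Type*} (t : BinaryTree A) : (shape t).numNodes = t.numNodes := by
  induction t with
  | nil => rfl
  | node b l r ihl ihr =>
    change (shape l).numNodes + (shape r).numNodes + 1 = _
    rw [ihl, ihr]
    rfl

theorem numNodes_rtree (w : List ℕ) : (rtree w).numNodes = w.length := by
  rw [rtree, numNodes_shape]
  induction w with
  | nil => rfl
  | cons x w ih => rw [List.foldr_cons, numNodes_insertRight, ih, List.length_cons]

/-- In the word `w`, the letter `j` is before no letter of the interval `[i, j)`. -/
def LastIn (w : List ℕ) (i j : ℕ) : Prop := ∀ k, i ≤ k → k < j → ¬ [j, k].Sublist w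

theorem pair_sublist_filter {w : List ℕ} {p : ℕ → Bool} {x y : ℕ} (hx : p x) (hy : p y) :
    [x, y].Sublist (w.filter p) ↔ [x, y].Sublist w := by
  refine ⟨fun h => h.trans List.filter_sublist, fun h => ?_⟩
  have := h.filter p
  simpa [hx, hy] using this

theorem lastIn_filter {w : List ℕ} {p : ℕ → Bool} {b i j : ℕ} (hp : ∀ k, i ≤ k → k ≤ j → p k)
    (hij : i < j) (hb : i ≤ b → b < j → False) :
    LastIn (w.filter p) i j ↔ LastIn (w ++ [b]) i j := by
  refine forall_congr' fun k => forall_congr' fun hk => forall_congr' fun hj => not_congr ?_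
  rw [pair_sublist_filter (hp _ hij.le le_rfl) (hp _ hk hj.le), pair_sublist_append]
  have h1 : ¬ [j, k].Sublist [b] := fun h => by simpa using h.length_le
  have h2 : k ≠ b := fun h => hb (h ▸ hk) (h ▸ hj)
  simp [h1, h2]

theorem lastIn_last {w : List ℕ} {b i : ℕ} (hb : b ∉ w) : LastIn (w ++ [b]) i b := by
  intro k _ _ h
  rw [pair_sublist_append] at h
  have h1 : ¬ [b, k].Sublist [b] := fun h => by simpa using h.length_le
  have h2 : ¬ [b, k].Sublist w := fun h => hb (h.subset (by simp))
  simp [h1, h2, hb] at h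

theorem not_lastIn_last {w : List ℕ} {b i j : ℕ} (hj : j ∈ w) (hi : i ≤ b) (hbj : b < j) :
    ¬ LastIn (w ++ [b]) i j := fun h =>
  h b hi hbj (pair_sublist_append.2 (.inr (.inl ⟨hj, by simp⟩)))

/-- The last letter `b` is the root. Pairs `(i, b)` always satisfy `LastIn`, pairs with `i ≤ b < j`
never do, and the others lie within one subtree, where induction applies. -/
theorem rtree_eq_iff_aux (m : ℕ) : ∀ w w' : List ℕ, w.length = m → w.Nodup → w.Perm w' →
    (rtree w = rtree w' ↔
      ∀ i ∈ w, ∀ j ∈ w, i < j → (LastIn w i j ↔ LastIn w' i j)) := by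
  induction m using Nat.strong_induction_on with
  | _ m ih =>
  intro w w' hm hw hp
  rcases List.eq_nil_or_concat' w with rfl | ⟨w, b, rfl⟩
  · simp [hp.nil_eq]
  rcases List.eq_nil_or_concat' w' with rfl | ⟨w', b', rfl⟩
  · simp at hp
  have hw' := hp.nodup_iff.1 hw
  have hb : b ∉ w := by
    have := (List.nodup_append'.1 hw).2.2
    simpa [List.disjoint_singleton] using this
  have hb' : b' ∉ w' := by
    have := (List.nodup_append'.1 hw').2.2
    simpa [List.disjoint_singleton] using this
  have hmem : ∀ x, (x ∈ w ∨ x = b) ↔ (x ∈ w' ∨ x = b') := fun x => by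
    simpa using hp.mem_iff (a := x)
  by_cases hbb : b = b'
  · subst hbb
    have hp : w.Perm w' := (List.perm_append_right_iff _).1 hp
    have hlen : ∀ p : ℕ → Bool, (w.filter p).length < m := fun p =>
      (List.length_filter_le p w).trans_lt (by simp [← hm])
    have hw := (List.nodup_append'.1 hw).1
    rw [rtree_concat, rtree_concat, BinaryTree.node.injEq,
      ih _ (hlen _) _ _ rfl (hw.filter _) (hp.filter _),
      ih _ (hlen _) _ _ rfl (hw.filter _) (hp.filter _)]
    simp only [true_and, List.mem_filter, decide_eq_true_eq]
    have hl : ∀ v : List ℕ, ∀ i j, i < j → j ≤ b →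
        (LastIn (v.filter (· ≤ b)) i j ↔ LastIn (v ++ [b]) i j) := fun v i j hij hj =>
      lastIn_filter (fun k _ hk => by simpa using hk.trans hj) hij (fun _ h => by omega)
    have hr : ∀ v : List ℕ, ∀ i j, i < j → b < i →
        (LastIn (v.filter (b < ·)) i j ↔ LastIn (v ++ [b]) i j) := fun v i j hij hi =>
      lastIn_filter (fun k hk _ => by simpa using hi.trans_le hk) hij (fun _ h => by omega)
    constructor
    · rintro ⟨h1, h2⟩ i hi j hj hij
      rw [List.mem_append, List.mem_singleton] at hi hj
      rcases eq_or_ne j b with rfl | hjb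
      · exact iff_of_true (lastIn_last hb) (lastIn_last hb')
      · have hj := hj.resolve_right hjb
        rcases lt_or_gt_of_ne hjb with hjb | hjb
        · have hi := hi.resolve_right (by omega)
          rw [← hl w i j hij hjb.le, ← hl w' i j hij hjb.le]
          exact h1 i ⟨hi, by omega⟩ j ⟨hj, by omega⟩ hij
        · rcases le_or_gt i b with hib | hib
          · exact iff_of_false (not_lastIn_last hj hib hjb)
              (not_lastIn_last (hp.mem_iff.1 hj) hib hjb)
          · have hi := hi.resolve_right (by omega)
            rw [← hr w i j hij hib, ← hr w' i j hij hib]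
            exact h2 i ⟨hi, by omega⟩ j ⟨hj, by omega⟩ hij
    · intro h
      constructor
      · rintro i ⟨hi, hib⟩ j ⟨hj, hjb⟩ hij
        rw [hl w i j hij hjb, hl w' i j hij hjb]
        exact h i (by simp [hi]) j (by simp [hj]) hij
      · rintro i ⟨hi, hib⟩ j ⟨hj, hjb⟩ hij
        rw [hr w i j hij hib, hr w' i j hij hib]
        exact h i (by simp [hi]) j (by simp [hj]) hij
  -- Distinct last letters are told apart on both sides: the left subtrees have different sizes, and
  -- `LastIn` differs on the pair formed by the two letters.
  · refine iff_of_false (fun h => ?_) fun h => ?_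
    · rw [rtree_concat, rtree_concat, BinaryTree.node.injEq] at h
      have hc := congrArg BinaryTree.numNodes h.2.1
      rw [numNodes_rtree, numNodes_rtree] at hc
      have h1 := (hp.filter (· ≤ b')).length_eq
      have h2 : ((w ++ [b]).filter (· ≤ b)).length = (w.filter (· ≤ b)).length + 1 := by simp
      have h3 : ((w' ++ [b']).filter (· ≤ b')).length = (w'.filter (· ≤ b')).length + 1 := by
        simp
      have aux : ∀ (l : List ℕ) (x y : ℕ), x < y → y ∈ l →
          (l.filter (· ≤ x)).length < (l.filter (· ≤ y)).length := by
        intro l x y hxy hy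
        have hs : (l.filter (· ≤ x)).Sublist (l.filter (· ≤ y)) :=
          List.monotone_filter_right _ fun z hz => by
            simp only [decide_eq_true_eq] at hz ⊢
            omega
        refine lt_of_le_of_ne hs.length_le fun he => ?_
        have : y ∈ l.filter (· ≤ x) := by
          rw [hs.eq_of_length he]
          simpa using hy
        simp only [List.mem_filter, decide_eq_true_eq] at this
        omega
      rcases lt_or_gt_of_ne hbb with hlt | hlt
      · have := aux (w ++ [b]) b b' hlt (by simpa using (hmem b').2 (.inr rfl))
        omega
      · have := aux (w ++ [b]) b' b hlt (by simp)
        omega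
    · have hbw : b ∈ w' := ((hmem b).1 (.inr rfl)).resolve_right hbb
      have hbw' : b' ∈ w := ((hmem b').2 (.inr rfl)).resolve_right (Ne.symm hbb)
      rcases lt_or_gt_of_ne hbb with hlt | hlt
      · exact not_lastIn_last hbw' le_rfl hlt
          ((h b (by simp) b' (by simp [hbw']) hlt).2 (lastIn_last hb'))
      · exact not_lastIn_last hbw le_rfl hlt
          ((h b' (by simp [hbw']) b (by simp) hlt).1 (lastIn_last hb))

theorem rtree_eq_iff {w w' : List ℕ} (hw : w.Nodup) (hp : w.Perm w') :
    rtree w = rtree w' ↔ ∀ i ∈ w, ∀ j ∈ w, i < j → (LastIn w i j ↔ LastIn w' i j) :=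
  rtree_eq_iff_aux _ w w' rfl hw hp

/-! ### Canopies -/

/-- The values of a function on the pairs of consecutive elements of a list. -/
def adjacentMap {β : Type*} (f : ℕ → ℕ → β) : List ℕ → List β
  | [] => []
  | [_] => []
  | x :: y :: l => f x y :: adjacentMap f (y :: l)

theorem adjacentMap_append {β : Type*} (f : ℕ → ℕ → β) (l₁ l₂ : List ℕ) (b : ℕ) :
    adjacentMap f (l₁ ++ b :: l₂) = adjacentMap f (l₁ ++ [b]) ++ adjacentMap f (b :: l₂) := by
  induction l₁ with
  | nil => rfl
  | cons x l ih =>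
    cases l with
    | nil => rfl
    | cons y l =>
      simp only [List.cons_append, adjacentMap] at ih ⊢
      rw [ih]

theorem adjacentMap_range' {β : Type*} (f : ℕ → ℕ → β) (a m : ℕ) :
    adjacentMap f (List.range' a (m + 1)) = (List.range' a m).map fun i => f i (i + 1) := by
  induction m generalizing a with
  | zero => rfl
  | succ m ih =>
    rw [List.range'_succ (n := m), List.map_cons, ← ih]
    rfl

/-- Each leaf sits between two neighbours of the sorted list and hangs from the one inserted later;
it is right-oriented when the smaller letter comes first in `w`. The sentinels `p` and `q` act as
ancestors bounding the subtree, which makes the statement pass to both subtrees of the root. -/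
theorem leafWord_rtree_aux (m : ℕ) : ∀ (w s : List ℕ) (f : ℕ → ℕ → Fin 2) (p q : ℕ),
    w.length = m → w.Nodup → s.Perm w → s.Pairwise (· < ·) → (∀ x ∈ w, f p x = 1) →
    (∀ x ∈ w, f x q = 0) →
    (∀ x ∈ w, ∀ y ∈ w, x < y → (f x y = 0 ↔ [x, y].Sublist w)) →
    leafWord (f p q) (rtree w) = adjacentMap f (p :: s ++ [q]) := by
  induction m using Nat.strong_induction_on with
  | _ m ih =>
  intro w s f p q hm hw hs hsort hp hq hf
  rcases List.eq_nil_or_concat' w with rfl | ⟨w, b, rfl⟩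
  · rw [hs.eq_nil]
    rfl
  have hb : b ∉ w := by
    have := (List.nodup_append'.1 hw).2.2
    simpa [List.disjoint_singleton] using this
  have hlen : ∀ p : ℕ → Bool, (w.filter p).length < m := fun p =>
    (List.length_filter_le p w).trans_lt (by simp [← hm])
  have hw₀ := (List.nodup_append'.1 hw).1
  obtain ⟨s₁, s₂, rfl⟩ := List.append_of_mem (hs.mem_iff.2 (by simp : b ∈ w ++ [b]))
  have hsn : (s₁ ++ b :: s₂).Nodup := hs.nodup_iff.2 hw
  have hmem : ∀ x, (x ∈ s₁ ∨ x = b ∨ x ∈ s₂) ↔ (x ∈ w ∨ x = b) := fun x => by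
    simpa using hs.mem_iff (a := x)
  rw [List.pairwise_append, List.pairwise_cons] at hsort
  obtain ⟨hs1, ⟨hbs2, hs2⟩, hs12⟩ := hsort
  have hs1b : ∀ x ∈ s₁, x < b := fun x hx => hs12 x hx b (by simp)
  have hf01 : ∀ z : Fin 2, z = 1 ↔ ¬ z = 0 := by decide
  have hfb : ∀ x ∈ w, x < b → f x b = 0 := fun x hx hxb =>
    (hf x (by simp [hx]) b (by simp) hxb).2 (pair_sublist_append.2 (.inr (.inl ⟨hx, by simp⟩)))
  have hbf : ∀ x ∈ w, b < x → f b x = 1 := fun x hx hxb => by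
    rw [hf01, hf b (by simp) x (by simp [hx]) hxb, pair_sublist_append]
    have h1 : ¬ [b, x].Sublist [b] := fun h => by simpa using h.length_le
    have h2 : ¬ [b, x].Sublist w := fun h => hb (h.subset (by simp))
    simp [h1, h2, hb]
  have hsub : ∀ x ∈ w, ∀ y ∈ w, x < y → (f x y = 0 ↔ [x, y].Sublist w) := by
    intro x hx y hy hxy
    rw [hf x (by simp [hx]) y (by simp [hy]) hxy, pair_sublist_append]
    have h1 : ¬ [x, y].Sublist [b] := fun h => by simpa using h.length_le
    have h2 : y ≠ b := fun h => hb (h ▸ hy)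
    simp [h1, h2]
  have hl := ih _ (hlen (· ≤ b)) (w.filter (· ≤ b)) s₁ f p b rfl (hw₀.filter _) (by
      rw [List.perm_ext_iff_of_nodup (List.nodup_append'.1 hsn).1 (hw₀.filter _)]
      intro x
      simp only [List.mem_filter, decide_eq_true_eq]
      constructor
      · intro hx
        have := hs1b x hx
        refine ⟨((hmem x).1 (.inl hx)).resolve_right (by omega), by omega⟩
      · rintro ⟨hx, hxb⟩
        rcases (hmem x).2 (.inl hx) with h | rfl | h
        · exact h
        · exact absurd hx hb
        · have := hbs2 x h
          omega) hs1
    (fun x hx => hp x (by simp [(List.mem_filter.1 hx).1]))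
    (fun x hx => by
      simp only [List.mem_filter, decide_eq_true_eq] at hx
      have : x ≠ b := fun h => hb (h ▸ hx.1)
      exact hfb x hx.1 (by omega))
    (fun x hx y hy hxy => by
      rw [List.mem_filter] at hx hy
      rw [pair_sublist_filter hx.2 hy.2, hsub x hx.1 y hy.1 hxy])
  have hr := ih _ (hlen (b < ·)) (w.filter (b < ·)) s₂ f b q rfl (hw₀.filter _) (by
      rw [List.perm_ext_iff_of_nodup (List.nodup_cons.1 (List.nodup_append'.1 hsn).2.1).2
        (hw₀.filter _)]
      intro x
      simp only [List.mem_filter, decide_eq_true_eq]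
      constructor
      · intro hx
        have := hbs2 x hx
        refine ⟨((hmem x).1 (.inr (.inr hx))).resolve_right (by omega), by omega⟩
      · rintro ⟨hx, hxb⟩
        rcases (hmem x).2 (.inl hx) with h | rfl | h
        · have := hs1b x h
          omega
        · exact absurd hx hb
        · exact h) hs2
    (fun x hx => by
      simp only [List.mem_filter, decide_eq_true_eq] at hx
      exact hbf x hx.1 hx.2)
    (fun x hx => hq x (by simp [(List.mem_filter.1 hx).1]))
    (fun x hx y hy hxy => by
      rw [List.mem_filter] at hx hy
      rw [pair_sublist_filter hx.2 hy.2, hsub x hx.1 y hy.1 hxy])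
  rw [hp b (by simp)] at hl
  rw [hq b (by simp)] at hr
  rw [rtree_concat, leafWord, hl, hr]
  have := adjacentMap_append f (p :: s₁) (s₂ ++ [q]) b
  simpa using this.symm

theorem tail_dropLast_adjacentMap {β : Type*} (f : ℕ → ℕ → β) (s : List ℕ) (p q : ℕ) :
    (adjacentMap f (p :: s ++ [q])).tail.dropLast = adjacentMap f s := by
  cases s with
  | nil => rfl
  | cons x s =>
    simp only [List.cons_append, adjacentMap, List.tail_cons]
    rcases List.eq_nil_or_concat' (x :: s) with h | ⟨l, y, h⟩
    · simp at h
    · rw [← List.cons_append, h, List.append_assoc]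
      change (adjacentMap f (l ++ y :: [q])).dropLast = _
      rw [adjacentMap_append]
      simp [adjacentMap]

open Classical in
theorem canopy_rtree {n : ℕ} {w : List ℕ} (hw : w.Nodup) (hn : ∀ x, x ∈ w ↔ x < n) :
    canopy (rtree w) =
      (List.range (n - 1)).map fun i => if [i, i + 1].Sublist w then 0 else 1 := by
  -- The unused letters `n` and `n + 1` are the left and right sentinels; the two outer leaves they
  -- govern are dropped from the canopy.
  let f : ℕ → ℕ → Fin 2 := fun x y =>
    if y = n + 1 then 0 else if x = n then 1 else if [x, y].Sublist w then 0 else 1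
  have h := leafWord_rtree_aux _ w (List.range n) f n (n + 1) rfl hw
    ((List.perm_ext_iff_of_nodup List.nodup_range hw).2 fun x => by rw [hn, List.mem_range])
    List.pairwise_lt_range
    (fun x hx => by
      have := (hn x).1 hx
      simp only [f]
      rw [if_neg (by omega), if_pos trivial])
    (fun x _ => by simp [f])
    (fun x hx y hy _ => by
      have := (hn x).1 hx
      have := (hn y).1 hy
      simp only [f]
      rw [if_neg (by omega), if_neg (by omega)]
      simp)
  have h0 : f n (n + 1) = 0 := by simp [f]
  rw [h0] at h
  rw [canopy, h, tail_dropLast_adjacentMap]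
  cases n with
  | zero => rfl
  | succ m =>
    rw [List.range_eq_range', adjacentMap_range', Nat.add_sub_cancel, ← List.range_eq_range']
    refine List.map_congr_left fun i hi => ?_
    rw [List.mem_range] at hi
    simp only [f]
    rw [if_neg (by omega), if_neg (by omega)]

theorem canopies_differ_iff {n : ℕ} {w w' : List ℕ} (hw : w.Nodup) (hn : ∀ x, x ∈ w ↔ x < n)
    (hw' : w'.Nodup) (hn' : ∀ x, x ∈ w' ↔ x < n) :
    List.Forall₂ (fun x y => x ≠ y) (canopy (rtree w)) (canopy (rtree w')) ↔
      ∀ i, i + 1 < n → ([i, i + 1].Sublist w ↔ ¬ [i, i + 1].Sublist w') := by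
  rw [canopy_rtree hw hn, canopy_rtree hw' hn', List.forall₂_map_left_iff,
    List.forall₂_map_right_iff, List.forall₂_same]
  refine forall_congr' fun i => ?_
  rw [List.mem_range]
  refine imp_congr (by omega) ?_
  by_cases h1 : [i, i + 1].Sublist w <;> by_cases h2 : [i, i + 1].Sublist w' <;> simp [h1, h2]

/-- Label the nodes in infix order from `o` and read them in postfix order, so that every root
follows its subtrees. -/
theorem exists_word_of_shape (t : BinaryTree Unit) : ∀ o : ℕ, ∃ w : List ℕ, w.Nodup ∧
    (∀ x, x ∈ w ↔ o ≤ x ∧ x < o + t.numNodes) ∧ rtree w = t := by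
  induction t with
  | nil => exact fun o => ⟨[], List.nodup_nil, fun x => by simp [BinaryTree.numNodes], rfl⟩
  | node a l r ihl ihr =>
    intro o
    obtain ⟨u, hu, hum, rfl⟩ := ihl o
    obtain ⟨v, hv, hvm, rfl⟩ := ihr (o + (rtree u).numNodes + 1)
    refine ⟨u ++ v ++ [o + (rtree u).numNodes], ?_, fun x => ?_, ?_⟩
    · simp only [List.nodup_append', hu, hv, true_and, List.nodup_singleton,
        List.disjoint_singleton, List.mem_append, hum, hvm]
      refine ⟨fun x hx hx' => ?_, by omega⟩
      rw [hum] at hx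
      rw [hvm] at hx'
      omega
    · simp only [List.mem_append, List.mem_singleton, hum, hvm, BinaryTree.numNodes]
      omega
    · rw [rtree_concat, List.filter_append, List.filter_append]
      congr 2
      · rw [List.filter_eq_self.2 fun x hx => ?_, List.filter_eq_nil_iff.2 fun x hx => ?_,
          List.append_nil]
        · rw [hvm] at hx
          simp only [decide_eq_true_eq]
          omega
        · rw [hum] at hx
          simp only [decide_eq_true_eq]
          omega
      · rw [List.filter_eq_nil_iff.2 fun x hx => ?_, List.filter_eq_self.2 fun x hx => ?_,
          List.nil_append]
        · rw [hvm] at hx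
          simp only [decide_eq_true_eq]
          omega
        · rw [hum] at hx
          simp only [decide_eq_true_eq]
          omega

end Trees
/-! ### The Baxter congruence on permutations -/

section Congruence

variable {n : ℕ}

theorem lastIn_append {w w' : List ℕ} {i j : ℕ} : LastIn (w ++ w') i j ↔
    LastIn w i j ∧ LastIn w' i j ∧ ∀ k, i ≤ k → k < j → ¬ (j ∈ w ∧ k ∈ w') := by
  simp only [LastIn, pair_sublist_append]
  constructor
  · intro h
    refine ⟨fun k h1 h2 h3 => h k h1 h2 (.inl h3), fun k h1 h2 h3 => h k h1 h2 (.inr (.inr h3)),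
      fun k h1 h2 h3 => h k h1 h2 (.inr (.inl h3))⟩
  · rintro ⟨h1, h2, h3⟩ k hk hj (h | h | h)
    · exact h1 k hk hj h
    · exact h3 k hk hj h
    · exact h2 k hk hj h

theorem lastIn_append_congr {u u' v v' : List ℕ} {i j : ℕ} (hu : u.Perm u') (hv : v.Perm v')
    (h1 : LastIn u i j ↔ LastIn u' i j) (h2 : LastIn v i j ↔ LastIn v' i j) :
    LastIn (u ++ v) i j ↔ LastIn (u' ++ v') i j := by
  simp only [lastIn_append, h1, h2, hu.mem_iff, hv.mem_iff]

/-- The exchange affects only whether `d` precedes `a`. Any interval `[i, d)` containing `a` also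
contains `b`, which already follows `d` in both words. -/
theorem lastIn_swap {u v : List ℕ} {a b d i j : ℕ} (hb : b ∈ v) (hab : a ≤ b) (hbd : b < d) :
    LastIn (u ++ [a, d] ++ v) i j ↔ LastIn (u ++ [d, a] ++ v) i j := by
  constructor
  · intro h k hk hj hs
    by_cases hc : j = d ∧ k = a
    · obtain ⟨rfl, rfl⟩ := hc
      exact h b (hk.trans hab) hbd (pair_sublist_append.2 (.inr (.inl ⟨by simp, hb⟩)))
    · exact h k hk hj (pair_sublist_swap hc hs)
  · exact fun h k hk hj hs => h k hk hj (pair_sublist_swap (by omega) hs)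

/-- Words with the same letters and, when there is no repetition, the same pairs `i < j` such that
`j` is before (resp. after) no letter of `[i, j)`. -/
def twinCon : Con (FreeMonoid ℕ) where
  -- The `Nodup` guard matters: generators with `c = d` need not preserve the condition on reversed
  -- words.
  r w w' := w.toList.Perm w'.toList ∧ (w.toList.Nodup → ∀ i j,
    (LastIn w.toList i j ↔ LastIn w'.toList i j) ∧
    (LastIn w.toList.reverse i j ↔ LastIn w'.toList.reverse i j))
  iseqv :=
    { refl := fun w => ⟨.refl _, fun _ _ _ => ⟨Iff.rfl, Iff.rfl⟩⟩
      symm := fun ⟨h1, h2⟩ => ⟨h1.symm, fun hn i j =>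
        ⟨(h2 (h1.nodup_iff.2 hn) i j).1.symm, (h2 (h1.nodup_iff.2 hn) i j).2.symm⟩⟩
      trans := fun ⟨h1, h2⟩ ⟨h3, h4⟩ => ⟨h1.trans h3, fun hn i j =>
        ⟨(h2 hn i j).1.trans (h4 (h1.nodup_iff.1 hn) i j).1,
          (h2 hn i j).2.trans (h4 (h1.nodup_iff.1 hn) i j).2⟩⟩ }
  mul' := by
    rintro u u' v v' ⟨h1, h2⟩ ⟨h3, h4⟩
    simp only [FreeMonoid.toList_mul]
    refine ⟨h1.append h3, fun hn i j => ?_⟩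
    obtain ⟨hu, hv, _⟩ := List.nodup_append'.1 hn
    refine ⟨lastIn_append_congr h1 h3 (h2 hu i j).1 (h4 hv i j).1, ?_⟩
    rw [List.reverse_append, List.reverse_append]
    refine lastIn_append_congr ?_ ?_ (h4 hv i j).2 (h2 hu i j).2
    · exact (List.reverse_perm _).trans (h3.trans (List.reverse_perm _).symm)
    · exact (List.reverse_perm _).trans (h1.trans (List.reverse_perm _).symm)

theorem twinCon_swap {u v : FreeMonoid ℕ} {a b c d : ℕ} (hc : c ∈ u.toList) (hb : b ∈ v.toList)
    (h : (u.toList ++ [a, d] ++ v.toList).Nodup → (a ≤ b ∧ b < d) ∧ (a ≤ c ∧ c < d)) :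
    twinCon (u * FreeMonoid.of a * FreeMonoid.of d * v)
      (u * FreeMonoid.of d * FreeMonoid.of a * v) := by
  have h1 : (u * FreeMonoid.of a * FreeMonoid.of d * v).toList =
      u.toList ++ [a, d] ++ v.toList := by simp [FreeMonoid.toList_mul]
  have h2 : (u * FreeMonoid.of d * FreeMonoid.of a * v).toList =
      u.toList ++ [d, a] ++ v.toList := by simp [FreeMonoid.toList_mul]
  change List.Perm _ _ ∧ _
  rw [h1, h2]
  refine ⟨((List.Perm.swap d a []).append_left _).append_right _, fun hn i j => ?_⟩
  obtain ⟨⟨hab, hbd⟩, hac, hcd⟩ := h hn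
  refine ⟨lastIn_swap hb hab hbd, ?_⟩
  have := lastIn_swap (u := v.toList.reverse) (v := u.toList.reverse) (i := i) (j := j)
    (List.mem_reverse.2 hc) hac hcd
  simpa using this.symm

theorem con_le_twinCon : con ℕ ≤ twinCon := by
  refine Con.conGen_le.2 ?_
  rintro _ _ (⟨u, v, a, b, c, d, hab, hbc, hcd⟩ | ⟨u, v, a, b, c, d, hab, hbc, hcd⟩)
  · have := twinCon_swap (u := FreeMonoid.of c * u) (v := v * FreeMonoid.of b) (a := a) (b := b)
      (c := c) (d := d) (by simp [FreeMonoid.toList_mul]) (by simp [FreeMonoid.toList_mul])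
      (fun hn => by
        have : c ≠ d := by
          rintro rfl
          simp [FreeMonoid.toList_mul] at hn
        omega)
    simpa only [mul_assoc] using this
  · have := twinCon_swap (u := FreeMonoid.of b * u) (v := v * FreeMonoid.of c) (a := a) (b := c)
      (c := b) (d := d) (by simp [FreeMonoid.toList_mul]) (by simp [FreeMonoid.toList_mul])
      (fun _ => by omega)
    simpa only [mul_assoc] using twinCon.symm this

/-! ### Full parts read on words -/

theorem full_iff_lastIn {X : Fin n → Fin n → Prop} {w : List ℕ}
    (hX : ∀ k j : Fin n, k < j → (X k j ↔ ¬ [(j : ℕ), (k : ℕ)].Sublist w)) {i j : Fin n}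
    (hij : i < j) : Full X i j ↔ LastIn w i j := by
  constructor
  · rintro ⟨_, h⟩ k hk hj hs
    have hkn : k < n := hj.trans j.2
    exact (hX ⟨k, hkn⟩ j hj).1 (h ⟨k, hkn⟩ hk hj) hs
  · exact fun h => ⟨hij, fun k hk hj => (hX k j hj).2 (h k hk hj)⟩

theorem full_compl_inv_iff {σ : Equiv.Perm (Fin n)} {i j : Fin n} (hij : i < j) :
    Full (Compl (inv σ)) i j ↔ LastIn (word σ).toList i j := by
  refine full_iff_lastIn (fun k j hkj => ?_) hij
  simp only [Compl, inv_iff_sublist, hkj, true_and]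

theorem full_inv_iff {σ : Equiv.Perm (Fin n)} {i j : Fin n} (hij : i < j) :
    Full (inv σ) i j ↔ LastIn (word σ).toList.reverse i j := by
  refine full_iff_lastIn (fun k j hkj => ?_) hij
  rw [← (biclosed_inv σ).compl_compl, Compl, compl_inv_iff, ← pair_sublist_word]
  simp only [hkj, true_and]
  rw [← List.reverse_sublist]
  simp

theorem full_eq_iff {X Y : Fin n → Fin n → Prop} :
    Full X = Full Y ↔ ∀ i j, i < j → (Full X i j ↔ Full Y i j) := by
  refine ⟨fun h i j _ => by rw [h], fun h => ?_⟩
  ext i j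
  by_cases hij : i < j
  · exact h i j hij
  · exact iff_of_false (fun h => hij h.1) fun h => hij h.1

theorem twinEquiv_of_con {σ ν : Equiv.Perm (Fin n)} (h : con ℕ (word σ) (word ν)) :
    TwinEquiv σ ν := by
  have h := (con_le_twinCon h).2 (nodup_word σ)
  constructor
  · rw [full_eq_iff]
    intro i j hij
    rw [full_inv_iff hij, full_inv_iff hij]
    exact (h i j).2
  · rw [full_eq_iff]
    intro i j hij
    rw [full_compl_inv_iff hij, full_compl_inv_iff hij]
    exact (h i j).1

/-- The order of the witnesses `b` and `c` decides which of the two Baxter relations applies. -/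
theorem con_of_between {u v : List ℕ} {a b c d : ℕ} (hc : c ∈ u) (hb : b ∈ v) (hne : b ≠ c)
    (hab : a < b) (hbd : b < d) (hac : a < c) (hcd : c < d) :
    con ℕ (FreeMonoid.ofList (u ++ [a, d] ++ v)) (FreeMonoid.ofList (u ++ [d, a] ++ v)) := by
  obtain ⟨u₁, u₂, rfl⟩ := List.append_of_mem hc
  obtain ⟨v₁, v₂, rfl⟩ := List.append_of_mem hb
  have key : con ℕ
      (FreeMonoid.of c * .ofList u₂ * FreeMonoid.of a * FreeMonoid.of d * .ofList v₁ *
        FreeMonoid.of b)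
      (FreeMonoid.of c * .ofList u₂ * FreeMonoid.of d * FreeMonoid.of a * .ofList v₁ *
        FreeMonoid.of b) := by
    rcases lt_or_gt_of_ne hne with h | h
    · exact ConGen.Rel.of _ _ (.left _ _ a b c d hab.le h hcd.le)
    · exact (con ℕ).symm (ConGen.Rel.of _ _ (.right _ _ a c b d hac h.le hbd))
  have := (con ℕ).mul ((con ℕ).mul ((con ℕ).refl (.ofList u₁)) key) ((con ℕ).refl (.ofList v₂))
  have e : ∀ x y, FreeMonoid.ofList (u₁ ++ c :: u₂ ++ [x, y] ++ (v₁ ++ b :: v₂)) =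
      .ofList u₁ * (FreeMonoid.of c * .ofList u₂ * FreeMonoid.of x * FreeMonoid.of y *
        .ofList v₁ * FreeMonoid.of b) * .ofList v₂ := fun x y => by
    apply FreeMonoid.toList.injective
    simp [FreeMonoid.toList_mul]
  rw [e, e]
  exact this

theorem con_of_permCover {σ ν : Equiv.Perm (Fin n)} (hc : PermCover σ ν) (h : TwinEquiv σ ν) :
    con ℕ (word σ) (word ν) := by
  obtain ⟨u, v, a, d, had, h1, h2⟩ := permCover_iff.1 hc
  have hσ := nodup_word σ
  rw [h1] at hσ
  have han : a < n := mem_word.1 (h1 ▸ by simp : a ∈ (word σ).toList)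
  have hdn : d < n := mem_word.1 (h1 ▸ by simp : d ∈ (word σ).toList)
  have hu : ∀ k, [k, d].Sublist (u ++ [a, d] ++ v) → k ≠ a → k ∈ u := by
    intro k hs hka
    simp only [List.nodup_append', List.nodup_cons, List.disjoint_left, List.mem_append,
      List.mem_cons, List.not_mem_nil, or_false] at hσ
    have h3 : ¬ [k, d].Sublist [a, d] := fun h => by
      simpa [hka] using h.eq_of_length (by simp)
    have h4 : ¬ [k, d].Sublist v := fun h => hσ.2.2 (.inr (.inr rfl)) (h.subset (by simp))
    have h5 : ¬ [k, d].Sublist u := fun h => hσ.1.2.2 (h.subset (by simp)) (.inr rfl)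
    have h6 : ¬ d ∈ v := fun h => hσ.2.2 (.inr (.inr rfl)) h
    simp only [pair_sublist_append] at hs
    tauto
  have hv : ∀ k, [d, k].Sublist (u ++ [a, d] ++ v) → k ∈ v := by
    intro k hs
    simp only [List.nodup_append', List.nodup_cons, List.disjoint_left, List.mem_append,
      List.mem_cons, List.not_mem_nil, or_false] at hσ
    have h3 : ¬ [d, k].Sublist [a, d] := fun h => by
      have := h.eq_of_length (by simp)
      simp only [List.cons.injEq] at this
      omega
    have h4 : ¬ [d, k].Sublist v := fun h => hσ.2.2 (.inr (.inr rfl)) (h.subset (by simp))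
    have h5 : ¬ [d, k].Sublist u := fun h => hσ.1.2.2 (h.subset (by simp)) (.inr rfl)
    have h6 : ¬ d ∈ u := fun h => hσ.1.2.2 h (.inr rfl)
    simp only [pair_sublist_append, List.mem_append] at hs
    tauto
  have hda : [d, a].Sublist (word ν).toList := by
    rw [h2, List.append_assoc]
    exact (List.sublist_append_left [d, a] v).trans (List.sublist_append_right _ _)
  have had' : [a, d].Sublist (word σ).toList := by
    rw [h1, List.append_assoc]
    exact (List.sublist_append_left [a, d] v).trans (List.sublist_append_right _ _)
  -- In `ν`, `d` precedes `a`, so `(a, d)` is not in the full part of the complement. Neither is it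
  -- for `σ`, where the obstruction must be a value other than `a` lying after `d`.
  obtain ⟨b, hb, hab, hbd⟩ : ∃ b ∈ v, a < b ∧ b < d := by
    have hn : ¬ Full (Compl (inv σ)) ⟨a, han⟩ ⟨d, hdn⟩ := by
      rw [h.2]
      exact fun hf => hf.rel.2 (inv_iff_sublist.2 ⟨had, hda⟩)
    rw [full_compl_inv_iff (Fin.lt_def.2 had), LastIn] at hn
    push Not at hn
    obtain ⟨k, hk, hkd, hs⟩ := hn
    refine ⟨k, hv k (h1 ▸ hs), lt_of_le_of_ne hk ?_, hkd⟩
    rintro rfl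
    have h3 := (pair_sublist_word (σ := σ) (a := ⟨a, han⟩) (b := ⟨d, hdn⟩)).1 had'
    exact lt_asymm h3 ((pair_sublist_word (σ := σ) (a := ⟨d, hdn⟩) (b := ⟨a, han⟩)).1 hs)
  -- Symmetrically, `(a, d)` is not full for the inversions of `σ`, hence not for those of `ν`,
  -- where some other value must precede `d`.
  obtain ⟨c, hc, hac, hcd⟩ : ∃ c ∈ u, a < c ∧ c < d := by
    have hn : ¬ Full (inv ν) ⟨a, han⟩ ⟨d, hdn⟩ := by
      rw [← h.1]
      exact fun hf => lt_asymm hf.rel.2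
        ((pair_sublist_word (σ := σ) (a := ⟨a, han⟩) (b := ⟨d, hdn⟩)).1 had')
    rw [full_inv_iff (Fin.lt_def.2 had), LastIn] at hn
    push Not at hn
    obtain ⟨k, hk, hkd, hs⟩ := hn
    have hs : [k, d].Sublist (word ν).toList := by
      rw [← List.reverse_sublist] at hs
      simpa using hs
    have hka : k ≠ a := by
      rintro rfl
      have h3 := (pair_sublist_word (σ := ν) (a := ⟨d, hdn⟩) (b := ⟨k, han⟩)).1 hda
      exact lt_asymm h3 ((pair_sublist_word (σ := ν) (a := ⟨k, han⟩) (b := ⟨d, hdn⟩)).1 hs)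
    refine ⟨k, hu k ?_ hka, lt_of_le_of_ne hk (Ne.symm hka), hkd⟩
    rw [h2] at hs
    exact pair_sublist_swap (by
      simp only at hkd
      omega) hs
  have hbc : b ≠ c := by
    rintro rfl
    exact (List.nodup_append'.1 hσ).2.2 (List.mem_append_left _ hc) hb
  have := con_of_between hc hb hbc hab hbd hac hcd
  rwa [← h1, ← h2] at this

/-- Full parts are monotone, so every permutation on a chain from `σ` to `ν` is squeezed into the
same class. -/
theorem con_of_permLE {σ ν : Equiv.Perm (Fin n)} (hl : PermLE σ ν) (h : TwinEquiv σ ν) :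
    con ℕ (word σ) (word ν) := by
  induction hl using Relation.ReflTransGen.head_induction_on with
  | refl => exact (con ℕ).refl _
  | @head σ τ hc hl ih =>
    have h1 : ∀ a b, inv σ a b → inv τ a b := fun a b => inv_of_permCover hc
    have h2 : ∀ a b, inv τ a b → inv ν a b := fun a b => inv_of_permLE hl
    have hτ : TwinEquiv τ ν := by
      constructor
      · ext i j
        exact ⟨Full.mono h2, fun hf => Full.mono h1 (h.1 ▸ hf)⟩
      · ext i j
        exact ⟨fun hf => h.2 ▸ Full.mono (fun _ _ => Compl.anti h1) hf,
          Full.mono fun _ _ => Compl.anti h2⟩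
    refine (con ℕ).trans (con_of_permCover hc ⟨h.1.trans hτ.1.symm, h.2.trans hτ.2.symm⟩) (ih hτ)

/-- Compatibility with meets puts `σ ⊓ ν` in the class of `σ ⊓ σ = σ`, giving a common lower bound
reachable by chains. -/
theorem con_iff_twinEquiv {σ ν : Equiv.Perm (Fin n)} :
    con ℕ (word σ) (word ν) ↔ TwinEquiv σ ν := by
  refine ⟨twinEquiv_of_con, fun h => ?_⟩
  let _ := weakOrder n
  have h1 : TwinEquiv (σ ⊓ ν) σ := by
    have := TwinEquiv.inf (σ := σ) (σ' := σ) (ν := ν) (ν' := σ) ⟨rfl, rfl⟩ ⟨h.1.symm, h.2.symm⟩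
    rwa [show (weakOrder n).inf σ σ = σ from inf_idem σ] at this
  have h2 : TwinEquiv (σ ⊓ ν) ν := ⟨h1.1.trans h.1, h1.2.trans h.2⟩
  exact (con ℕ).trans
    ((con ℕ).symm (con_of_permLE (permLE_iff.2 (inf_le_left : σ ⊓ ν ≤ σ)) h1))
    (con_of_permLE (permLE_iff.2 (inf_le_right : σ ⊓ ν ≤ ν)) h2)

/-! ### P-symbols in terms of full parts -/

theorem word_perm (σ ν : Equiv.Perm (Fin n)) : (word σ).toList.Perm (word ν).toList :=
  (List.perm_ext_iff_of_nodup (nodup_word σ) (nodup_word ν)).2 fun x => by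
    rw [mem_word, mem_word]

theorem permShape_eq (σ : Equiv.Perm (Fin n)) :
    permShape σ = (rtree (word σ).toList.reverse, rtree (word σ).toList) :=
  congrArg (·, rtree (word σ).toList) (ltree_eq (nodup_word σ))

theorem permShape_fst_eq_iff {σ ν : Equiv.Perm (Fin n)} :
    (permShape σ).1 = (permShape ν).1 ↔ Full (inv σ) = Full (inv ν) := by
  rw [permShape_eq, permShape_eq, rtree_eq_iff (List.nodup_reverse.2 (nodup_word σ))
    ((List.reverse_perm _).trans ((word_perm σ ν).trans (List.reverse_perm _).symm)), full_eq_iff]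
  simp only [List.mem_reverse, mem_word]
  refine ⟨fun h i j hij => ?_, fun h i hi j hj hij => ?_⟩
  · rw [full_inv_iff hij, full_inv_iff hij]
    exact h i i.2 j j.2 hij
  · have := h ⟨i, hi⟩ ⟨j, hj⟩ hij
    rwa [full_inv_iff hij, full_inv_iff hij] at this

theorem permShape_snd_eq_iff {σ ν : Equiv.Perm (Fin n)} :
    (permShape σ).2 = (permShape ν).2 ↔ Full (Compl (inv σ)) = Full (Compl (inv ν)) := by
  rw [permShape_eq, permShape_eq, rtree_eq_iff (nodup_word σ) (word_perm σ ν), full_eq_iff]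
  simp only [mem_word]
  refine ⟨fun h i j hij => ?_, fun h i hi j hj hij => ?_⟩
  · rw [full_compl_inv_iff hij, full_compl_inv_iff hij]
    exact h i i.2 j j.2 hij
  · have := h ⟨i, hi⟩ ⟨j, hj⟩ hij
    rwa [full_compl_inv_iff hij, full_compl_inv_iff hij] at this

theorem permShape_eq_iff {σ ν : Equiv.Perm (Fin n)} :
    permShape σ = permShape ν ↔ TwinEquiv σ ν := by
  rw [Prod.ext_iff, permShape_fst_eq_iff, permShape_snd_eq_iff, TwinEquiv]

end Congruence
/-! ### Surjectivity of the P-symbol -/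

section Surjective

/-- The pairs `(i, j)` such that `X i k` for all `k` in the interval `(i, j]`. -/
def RightFull {α : Type*} [LinearOrder α] (X : α → α → Prop) (i j : α) : Prop :=
  i < j ∧ ∀ k, i < k → k ≤ j → X i k

theorem RightFull.rel {α : Type*} [LinearOrder α] {X : α → α → Prop} {i j : α}
    (h : RightFull X i j) : X i j := h.2 j h.1 le_rfl

theorem Biclosed.rightFull {α : Type*} [LinearOrder α] {X : α → α → Prop} (hX : Biclosed X) :
    Biclosed (RightFull X) where
  lt h := h.1
  trans {a b c} h1 h2 := ⟨h1.1.trans h2.1, fun k hk hc => by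
    rcases le_or_gt k b with hb | hb
    · exact h1.2 k hk hb
    · exact hX.trans h1.rel (h2.2 k hb hc)⟩
  cotrans h1 h2 h := .inl ⟨h1, fun k hk hb => h.2 k hk (hb.trans h2.le)⟩

/-- Take the largest `k` in `[i, j)` with `¬ X k j`: if `X k m` for some `m` in `(k, j)`, then `X m
j` by maximality, and transitivity gives `X k j`. -/
theorem Biclosed.exists_rightFull_compl {α : Type*} [LinearOrder α] [WellFoundedGT α]
    {X : α → α → Prop} (hX : Biclosed X) {i j : α} (hij : i < j) (h : ¬ Full X i j) :
    ∃ k, i ≤ k ∧ k < j ∧ RightFull (Compl X) k j := by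
  have h : ∃ k, i ≤ k ∧ k < j ∧ ¬ X k j := by
    by_contra hc
    push Not at hc
    exact h ⟨hij, hc⟩
  obtain ⟨k, ⟨hk, hkj, hX'⟩, hmax⟩ := wellFounded_gt.has_min {k | i ≤ k ∧ k < j ∧ ¬ X k j} h
  refine ⟨k, hk, hkj, hkj, fun m hkm hmj => ⟨hkm, fun hm => ?_⟩⟩
  rcases hmj.eq_or_lt with rfl | hmj
  · exact hX' hm
  · refine hX' (hX.trans hm ?_)
    by_contra hc
    exact hmax m ⟨hk.trans hkm.le, hmj, hc⟩ hkm

variable {n : ℕ}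

/-- The relation is `Join (Full X) (RightFull Y)`. It contains what must be present, and it avoids
`RightFull (Compl X)` and `Full (Compl Y)`, which keeps its full parts from being too large or too
small. -/
theorem exists_perm_full {X Y : Fin n → Fin n → Prop} (hX : Biclosed X) (hY : Biclosed Y)
    (h : ∀ (i : ℕ) (hi : i + 1 < n),
      X ⟨i, by omega⟩ ⟨i + 1, hi⟩ ↔ Y ⟨i, by omega⟩ ⟨i + 1, hi⟩) :
    ∃ σ : Equiv.Perm (Fin n),
      Full (inv σ) = Full X ∧ Full (Compl (inv σ)) = Full (Compl Y) := by
  have hL := hX.full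
  have hR := hY.rightFull
  have hN := hX.compl.rightFull
  have hM := hY.compl.full
  -- Both conditions speak of the pair `(j - 1, j)`, on which `X` and `Y` agree; `disj'` uses `(i, i
  -- + 1)` likewise.
  have disj : ∀ i j, Full X i j → ¬ Full (Compl Y) i j := by
    rintro i ⟨j, hj⟩ h1 h2
    have hij : (i : ℕ) < j := h1.1
    obtain ⟨m, rfl⟩ : ∃ m, j = m + 1 := ⟨j - 1, by omega⟩
    have him : i ≤ (⟨m, by omega⟩ : Fin n) := Fin.le_def.2 (by simp only; omega)
    have hm : (⟨m, by omega⟩ : Fin n) < ⟨m + 1, hj⟩ := Fin.lt_def.2 (by simp)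
    exact (h2.2 _ him hm).2 ((h m hj).1 (h1.2 _ him hm))
  have disj' : ∀ i j, RightFull Y i j → ¬ RightFull (Compl X) i j := by
    rintro ⟨i, hi⟩ j h1 h2
    have hij : i < (j : ℕ) := h1.1
    have hj := j.2
    have hm : (⟨i, hi⟩ : Fin n) < ⟨i + 1, by omega⟩ := Fin.lt_def.2 (by simp)
    have hmj : (⟨i + 1, by omega⟩ : Fin n) ≤ j := Fin.le_def.2 (by simp only; omega)
    exact (h2.2 _ hm hmj).2 ((h i (by omega)).2 (h1.2 _ hm hmj))
  have hJ : Biclosed (Join (Full X) (RightFull Y)) := hL.join hR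
  -- The complement of a biclosed relation is transitive, so a join avoids that relation as soon as
  -- its two terms do.
  have hJN : ∀ i j, Join (Full X) (RightFull Y) i j → ¬ RightFull (Compl X) i j := fun i j hj =>
    (Join.le hN.compl (fun a b hab => ⟨hab.1, fun hc => hc.rel.2 hab.rel⟩)
      (fun a b hab => ⟨hab.1, disj' a b hab⟩) hj).2
  have hJM : ∀ i j, Join (Full X) (RightFull Y) i j → ¬ Full (Compl Y) i j := fun i j hj =>
    (Join.le hM.compl (fun a b hab => ⟨hab.1, disj a b hab⟩)
      (fun a b hab => ⟨hab.1, fun hc => hc.rel.2 hab.rel⟩) hj).2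
  refine ⟨hJ.perm, ?_, ?_⟩
  · rw [hJ.inv_perm]
    ext i j
    constructor
    · intro hf
      by_contra hc
      obtain ⟨k, hk, hkj, hN'⟩ := hX.exists_rightFull_compl hf.1 hc
      exact hJN k j (hf.2 k hk hkj) hN'
    · exact fun hf => ⟨hf.1, fun k hk hkj => Join.left (hf.shrink hk hkj)⟩
  · rw [hJ.inv_perm]
    ext i j
    constructor
    · intro hf
      by_contra hc
      obtain ⟨k, hk, hkj, hR'⟩ := hY.compl.exists_rightFull_compl hf.1 hc
      rw [hY.compl_compl] at hR'
      exact (hf.2 k hk hkj).2 (Join.right hR')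
    · exact fun hf => ⟨hf.1, fun k hk hkj =>
        ⟨hkj, fun hj => hJM k j hj (hf.shrink hk hkj)⟩⟩

theorem inv_succ_iff {σ : Equiv.Perm (Fin n)} {i : ℕ} (hi : i + 1 < n) :
    inv σ ⟨i, by omega⟩ ⟨i + 1, hi⟩ ↔ [i, i + 1].Sublist (word σ).toList.reverse := by
  rw [inv_iff_sublist, ← List.reverse_sublist]
  simp [Fin.lt_def]

theorem not_inv_succ_iff {σ : Equiv.Perm (Fin n)} {i : ℕ} (hi : i + 1 < n) :
    ¬ inv σ ⟨i, by omega⟩ ⟨i + 1, hi⟩ ↔ [i, i + 1].Sublist (word σ).toList := by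
  have hlt : (⟨i, by omega⟩ : Fin n) < ⟨i + 1, hi⟩ := Fin.lt_def.2 (by simp)
  have h1 := compl_inv_iff (σ := σ) (a := ⟨i, by omega⟩) (b := ⟨i + 1, hi⟩)
  rw [Compl, ← pair_sublist_word] at h1
  simpa [hlt] using h1

theorem canopies_permShape_iff {σ ν : Equiv.Perm (Fin n)} :
    List.Forall₂ (fun x y => x ≠ y) (canopy (permShape σ).1) (canopy (permShape ν).2) ↔
      ∀ (i : ℕ) (hi : i + 1 < n),
        inv σ ⟨i, by omega⟩ ⟨i + 1, hi⟩ ↔ inv ν ⟨i, by omega⟩ ⟨i + 1, hi⟩ := by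
  rw [permShape_eq, permShape_eq, canopies_differ_iff (n := n)
    (List.nodup_reverse.2 (nodup_word σ)) (fun x => by rw [List.mem_reverse, mem_word])
    (nodup_word ν) fun x => mem_word]
  refine forall_congr' fun i => forall_congr' fun hi => ?_
  rw [← inv_succ_iff hi, ← not_inv_succ_iff hi, not_not]

/-- The pair of twin binary trees of a permutation. -/
def twinTrees (σ : Equiv.Perm (Fin n)) : TwinTrees n :=
  ⟨permShape σ, by
    rw [permShape_eq, numNodes_rtree]
    simp [toList_word], by
    rw [permShape_eq, numNodes_rtree]
    simp [toList_word], canopies_permShape_iff.2 fun _ _ => Iff.rfl⟩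

theorem exists_perm_of_rtree {t : BinaryTree Unit} (ht : t.numNodes = n) :
    ∃ σ : Equiv.Perm (Fin n), (permShape σ).2 = t := by
  obtain ⟨w, hw, hm, rfl⟩ := exists_word_of_shape t 0
  obtain ⟨σ, rfl⟩ := exists_perm_of_word (n := n) hw fun x => by rw [hm, ht]; simp
  exact ⟨σ, rfl⟩

theorem exists_perm_of_ltree {t : BinaryTree Unit} (ht : t.numNodes = n) :
    ∃ σ : Equiv.Perm (Fin n), (permShape σ).1 = t := by
  obtain ⟨w, hw, hm, rfl⟩ := exists_word_of_shape t 0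
  obtain ⟨σ, hσ⟩ := exists_perm_of_word (n := n) (List.nodup_reverse.2 hw) fun x => by
    rw [List.mem_reverse, hm, ht]
    simp
  refine ⟨σ, ?_⟩
  rw [permShape_eq, hσ, List.reverse_reverse]

theorem twinTrees_surjective : Function.Surjective (twinTrees (n := n)) := by
  rintro ⟨⟨t₁, t₂⟩, h1, h2, h3⟩
  obtain ⟨ρ, rfl⟩ := exists_perm_of_ltree h1
  obtain ⟨τ, rfl⟩ := exists_perm_of_rtree h2
  obtain ⟨σ, hσ⟩ := exists_perm_full (biclosed_inv ρ) (biclosed_inv τ)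
    (canopies_permShape_iff.1 h3)
  exact ⟨σ, Subtype.ext (Prod.ext (permShape_fst_eq_iff.2 hσ.1)
    (permShape_snd_eq_iff.2 hσ.2))⟩

end Surjective

/-! ### The quotient lattice and the Baxter lattice -/

section Quotients

/-- The operations induced by a lattice congruence on the quotient. -/
@[reducible] def quotientLattice {α : Type*} [Lattice α] (c : LatticeCon α) :
    Lattice (Quotient c.toSetoid) :=
  @Lattice.mk' _ ⟨Quotient.map₂ (· ⊔ ·) fun _ _ h _ _ h' => c.sup h h'⟩
    ⟨Quotient.map₂ (· ⊓ ·) fun _ _ h _ _ h' => c.inf h h'⟩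
    (by
      rintro ⟨a⟩ ⟨b⟩
      exact congrArg (Quotient.mk _) (sup_comm a b))
    (by
      rintro ⟨a⟩ ⟨b⟩ ⟨d⟩
      exact congrArg (Quotient.mk _) (sup_assoc a b d))
    (by
      rintro ⟨a⟩ ⟨b⟩
      exact congrArg (Quotient.mk _) (inf_comm a b))
    (by
      rintro ⟨a⟩ ⟨b⟩ ⟨d⟩
      exact congrArg (Quotient.mk _) (inf_assoc a b d))
    (by
      rintro ⟨a⟩ ⟨b⟩
      exact congrArg (Quotient.mk _) sup_inf_self)
    (by
      rintro ⟨a⟩ ⟨b⟩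
      exact congrArg (Quotient.mk _) inf_sup_self)

theorem quotientLattice_mk_le {α : Type*} [Lattice α] (c : LatticeCon α) (a b : α) :
    (quotientLattice c).le (Quotient.mk _ a) (Quotient.mk _ b) ↔
      ∃ b', a ≤ b' ∧ c.toSetoid b' b := by
  change Quotient.mk c.toSetoid (a ⊔ b) = Quotient.mk c.toSetoid b ↔ _
  constructor
  · exact fun h => ⟨a ⊔ b, le_sup_left, Quotient.exact h⟩
  · rintro ⟨b', hab, hb⟩
    refine Quotient.sound (c.trans (c.sup (c.refl a) (c.symm hb)) ?_)
    rwa [sup_eq_right.2 hab]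

/-- The order of the quotient lattice is the order induced on classes. -/
theorem quotient_le_iff {α : Type*} [Lattice α] (c : LatticeCon α) (x y : Quotient c.toSetoid) :
    x ≤ y ↔ (quotientLattice c).le x y := by
  obtain ⟨a, rfl⟩ := Quotient.exists_rep x
  obtain ⟨b, rfl⟩ := Quotient.exists_rep y
  rw [Quotient.le_def]
  constructor
  · have step : ∀ {a b : α}, (a ≤ b ∨ c.toSetoid a b) →
        (quotientLattice c).le (Quotient.mk _ a) (Quotient.mk _ b) := by
      rintro a b (h | h)
      · exact (quotientLattice_mk_le c a b).2 ⟨b, h, c.refl b⟩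
      · exact (quotientLattice_mk_le c a b).2 ⟨a, le_rfl, h⟩
    intro h
    induction h with
    | single h => exact step h
    | tail _ h ih => exact (quotientLattice c).le_trans _ _ _ ih (step h)
  · intro h
    obtain ⟨b', h1, h2⟩ := (quotientLattice_mk_le c a b).1 h
    exact .tail (.single (.inl h1)) (.inr h2)

/-- The lattice structure transported along a bijection. -/
@[reducible] def transportLattice {α β : Type*} [Lattice α] (e : β ≃ α) : Lattice β where
  le x y := e x ≤ e y
  le_refl x := le_refl (e x)
  le_trans x y z h1 h2 := le_trans (α := α) h1 h2
  le_antisymm x y h1 h2 := e.injective (le_antisymm (α := α) h1 h2)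
  sup x y := e.symm (e x ⊔ e y)
  inf x y := e.symm (e x ⊓ e y)
  le_sup_left x y := by simp
  le_sup_right x y := by simp
  sup_le x y z h1 h2 := by simpa using ⟨h1, h2⟩
  inf_le_left x y := by simp
  inf_le_right x y := by simp
  le_inf x y z h1 h2 := by simpa using ⟨h1, h2⟩

variable (n : ℕ)

/-- The Baxter equivalence relation as a congruence of the weak order. -/
@[reducible] noncomputable def baxterCon :
    @LatticeCon (Equiv.Perm (Fin n)) (weakOrder n) :=
  let _ := weakOrder n
  { permSetoid n with
    inf := fun h h' => con_iff_twinEquiv.2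
      ((con_iff_twinEquiv.1 h).inf (con_iff_twinEquiv.1 h'))
    sup := fun h h' => con_iff_twinEquiv.2
      ((con_iff_twinEquiv.1 h).sup (con_iff_twinEquiv.1 h')) }

theorem twinTrees_eq_iff {σ ν : Equiv.Perm (Fin n)} :
    twinTrees σ = twinTrees ν ↔ permSetoid n σ ν := by
  change _ ↔ con ℕ (word σ) (word ν)
  rw [con_iff_twinEquiv, ← permShape_eq_iff]
  exact Subtype.ext_iff

/-- The bijection from Baxter classes to pairs of twin binary trees given by the P-symbol. -/
noncomputable def twinTreesEquiv : Quotient (permSetoid n) ≃ TwinTrees n :=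
  Equiv.ofBijective (Quotient.lift twinTrees fun _ _ h => (twinTrees_eq_iff n).2 h) ⟨by
    rintro ⟨σ⟩ ⟨ν⟩ h
    exact Quotient.sound ((twinTrees_eq_iff n).1 h), fun J => by
    obtain ⟨σ, rfl⟩ := twinTrees_surjective J
    exact ⟨Quotient.mk _ σ, rfl⟩⟩

theorem twinTreesEquiv_mk (σ : Equiv.Perm (Fin n)) :
    twinTreesEquiv n (Quotient.mk _ σ) = twinTrees σ := rfl

/-- Representatives `σ' ≤ ν'` can be moved to start at any `σ` equivalent to `σ'`: `σ ≤ σ ⊔ ν'`,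
which is equivalent to `σ' ⊔ ν' = ν'`. -/
theorem twinLE_iff (J₀ J₁ : TwinTrees n) :
    (let _ := weakOrder n; (quotientLattice (baxterCon n)).le) ((twinTreesEquiv n).symm J₀)
      ((twinTreesEquiv n).symm J₁) ↔ TwinLE J₀ J₁ := by
  obtain ⟨σ, rfl⟩ := twinTrees_surjective J₀
  obtain ⟨ν, rfl⟩ := twinTrees_surjective J₁
  let _ := weakOrder n
  rw [← twinTreesEquiv_mk, ← twinTreesEquiv_mk, Equiv.symm_apply_apply, Equiv.symm_apply_apply]
  refine (quotientLattice_mk_le (baxterCon n) σ ν).trans ?_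
  constructor
  · rintro ⟨ν', h1, h2⟩
    exact ⟨σ, ν', permLE_iff.2 h1, rfl, congrArg Subtype.val ((twinTrees_eq_iff n).2 h2)⟩
  · rintro ⟨σ', ν', h1, h2, h3⟩
    have hσ : baxterCon n |>.toSetoid σ' σ := (twinTrees_eq_iff n).1 (Subtype.ext h2)
    have hν : baxterCon n |>.toSetoid ν' ν := (twinTrees_eq_iff n).1 (Subtype.ext h3)
    have hle : σ' ≤ ν' := permLE_iff.1 h1
    refine ⟨σ ⊔ ν', le_sup_left, ?_⟩
    have := (baxterCon n).sup ((baxterCon n).symm hσ) ((baxterCon n).refl ν')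
    rw [sup_eq_right.2 hle] at this
    exact (baxterCon n).trans this hν

end Quotients

end Baxter

open Baxter in
theorem mainTheorem5 (n : ℕ) :
    -- the permutohedron is a lattice
    ∃ L : Lattice (Equiv.Perm (Fin n)),
      (∀ σ ν : Equiv.Perm (Fin n), σ ≤ ν ↔ Baxter.PermLE σ ν) ∧
      -- the Baxter equivalence relation is a lattice congruence of it
      (∃ c : LatticeCon (Equiv.Perm (Fin n)), c.toSetoid = Baxter.permSetoid n) ∧
      -- the quotient lattice, with the operations induced on classes
      ∃ Q : Lattice (Quotient (Baxter.permSetoid n)),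
        (∀ σ ν : Equiv.Perm (Fin n),
          Quotient.mk (Baxter.permSetoid n) σ ⊓ Quotient.mk (Baxter.permSetoid n) ν =
              Quotient.mk (Baxter.permSetoid n) (σ ⊓ ν) ∧
            Quotient.mk (Baxter.permSetoid n) σ ⊔ Quotient.mk (Baxter.permSetoid n) ν =
              Quotient.mk (Baxter.permSetoid n) (σ ⊔ ν)) ∧
        -- the Baxter lattice on pairs of twin binary trees, isomorphic to it by the P-symbol
        ∃ B : Lattice (Baxter.TwinTrees n),
          (∀ J₀ J₁ : Baxter.TwinTrees n, J₀ ≤ J₁ ↔ Baxter.TwinLE J₀ J₁) ∧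
          ∃ e : Quotient (Baxter.permSetoid n) ≃o Baxter.TwinTrees n,
            ∀ σ : Equiv.Perm (Fin n),
              (e (Quotient.mk (Baxter.permSetoid n) σ)).1 = Baxter.permShape σ := by
  let _ := weakOrder n
  refine ⟨weakOrder n, fun _ _ => permLE_iff.symm, ⟨baxterCon n, rfl⟩,
    quotientLattice (baxterCon n), fun _ _ => ⟨rfl, rfl⟩, ?_⟩
  refine ⟨@transportLattice _ _ (quotientLattice (baxterCon n)) (twinTreesEquiv n).symm,
    fun J₀ J₁ => twinLE_iff n J₀ J₁, ⟨twinTreesEquiv n, fun {x y} => ?_⟩, fun _ => rfl⟩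
  -- The order on the quotient used by `≃o` is generated from that of representatives; it is first
  -- identified with the order of the quotient lattice.
  refine Iff.trans ?_ (quotient_le_iff (baxterCon n) x y).symm
  change (quotientLattice (baxterCon n)).le ((twinTreesEquiv n).symm _)
    ((twinTreesEquiv n).symm _) ↔ _
  rw [Equiv.symm_apply_apply, Equiv.symm_apply_apply]
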